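/- **Theorem.** Let $M\subset\mathbb{R}^3$, with coordinates $(t,x,u)$, be a nonempty connected open set whose slices $\{t=\mathrm{const}\}$ are connected and on which $\cos u\neq 0$. On $M$ consider the realization $$\mathsf{so}(3,\mathbb{R})=\langle e_1,e_2,e_3\rangle=\langle \partial_x,\ \tan u\,\sin x\,\partial_x+\cos x\,\partial_u,\ \tan u\,\cos x\,\partial_x-\sin x\,\partial_u\rangle .$$ Call a set of smooth vector fields on $M$ *admissible* if all its members are infinitesimal point symmetries of one and the same evolution equation $$u_t=F(t,x,u,u_x,u_{xx})\,u_{xxx}+G(t,x,u,u_x,u_{xx}),$$ where $F,G$ are smooth on an open set $N\subset\mathbb{R}^5$ whose projection to $(t,x,u)$-space is $M$, and $F$ is not identically zero on any nonempty open subset of $N$. (A vector field is an infinitesimal point symmetry if its third prolongation annihilates $u_t-Fu_{xxx}-G$ on the solution manifold of the equation.) An *abelian irreducible representation space* on $M$ is a nonzero finite-dimensional real vector space $\mathsf{A}$ of pairwise commuting smooth vector fields on $M$ such that $[e_i,\mathsf{A}]\subset\mathsf{A}$ for $i=1,2,3$ and such that $\mathsf{A}$ has no subspaces invariant under $\mathrm{ad}_{e_1},\mathrm{ad}_{e_2},\mathrm{ad}_{e_3}$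 other than $\{0\}$ and $\mathsf{A}$. Then: 1. $\langle\partial_t\rangle$ is a one-dimensional abelian irreducible representation space on $M$, and $\{e_1,e_2,e_3\}\cup\langle\partial_t\rangle$ is admissible. 2. Every admissible abelian irreducible representation space $\mathsf{A}$ on $M$ has $\dim\mathsf{A}=1$ (in particular, there is none with $\dim\mathsf{A}\geq 2$) and is equivalent to $\langle\partial_t\rangle$: there is a smooth invertible transformation, with smooth inverse, $t'=T(t),\ x'=X(t,x,u),\ u'=U(t,x,u)$ of $M$ onto a set $M'\subset\mathbb{R}^3$ of the same kind as $M$, which maps each of $e_1,e_2,e_3$ to the vector field given by the same formula in $(t',x',u')$ and maps $\mathsf{A}$ onto $\langle\partial_{t'}\rangle$. -/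

import Mathlib

open scoped ContDiff

namespace EvolSym

/-- Points `(t, x, u)`: `p 0 = t`, `p 1 = x`, `p 2 = u`. -/
abbrev Pt := Fin 3 → ℝ

/-- Points `(t, x, u, u_x, u_xx)`, the arguments of the coefficients `F`, `G` of the equation
`u_t = F(t, x, u, u_x, u_xx) u_xxx + G(t, x, u, u_x, u_xx)`. -/
abbrev EqPt := Fin 5 → ℝ

/-- The coordinates `(t, x, u, u_t, u_x, u_tx, u_xx, u_txx, u_xxx)` (in this order, indices
`0, …, 8`) of the third-order jet space.  The remaining coordinates `u_tt, u_ttx, u_ttt` of the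
jet space enter neither the equation nor the prolongation coefficients needed below. -/
abbrev Jet := Fin 9 → ℝ

/-- The projection of a jet to `(t, x, u)`. -/
def Jet.base (z : Jet) : Pt := ![z 0, z 1, z 2]

/-- The projection of a jet to `(t, x, u, u_x, u_xx)`. -/
def Jet.eqPt (z : Jet) : EqPt := ![z 0, z 1, z 2, z 4, z 6]

/-- The projection `(t, x, u, u_x, u_xx) ↦ (t, x, u)`. -/
def EqPt.base (q : EqPt) : Pt := ![q 0, q 1, q 2]

/-! ### Smooth vector fields -/

/-- The vector field `a ∂_t + b ∂_x + c ∂_u` is given by its coefficient vector `(a, b, c)`.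
A smooth vector field on the open set `M` is represented by its extension by zero outside `M`,
so that two representatives are equal if and only if the fields agree on `M`. -/
def smoothFields (M : Set Pt) : Submodule ℝ (Pt → Pt) where
  carrier := {V | ContDiffOn ℝ ∞ V M ∧ ∀ p, p ∉ M → V p = 0}
  add_mem' := by
    rintro V W ⟨hV, hV0⟩ ⟨hW, hW0⟩
    refine ⟨hV.add hW, fun p hp => ?_⟩
    simp [hV0 p hp, hW0 p hp]
  zero_mem' := ⟨contDiffOn_const, fun _ _ => rfl⟩
  smul_mem' := by
    rintro r V ⟨hV, hV0⟩
    refine ⟨contDiffOn_const.smul hV, fun p hp => ?_⟩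
    simp [hV0 p hp]

/-- The field `∂_t` on `M`. -/
noncomputable def dtField (M : Set Pt) : Pt → Pt := M.indicator fun _ => ![1, 0, 0]

/-- The three generators of the realization of `so(3, ℝ)` on `M`:
`e₁ = ∂_x`, `e₂ = tan u sin x ∂_x + cos x ∂_u`, `e₃ = tan u cos x ∂_x - sin x ∂_u`. -/
noncomputable def so3Field (M : Set Pt) : Fin 3 → Pt → Pt :=
  ![M.indicator fun _ => ![0, 1, 0],
    M.indicator fun p => ![0, Real.tan (p 2) * Real.sin (p 1), Real.cos (p 1)],
    M.indicator fun p => ![0, Real.tan (p 2) * Real.cos (p 1), -Real.sin (p 1)]]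

/-! ### Point symmetries of evolution equations -/

/-- The total derivative `D_x` of a function on jets which depends only on
`(t, x, u, u_t, u_x, u_tx, u_xx)`. -/
noncomputable def totalDx (f : Jet → ℝ) (z : Jet) : ℝ :=
  fderiv ℝ f z ![0, 1, z 4, z 5, z 6, z 7, z 8, 0, 0]

/-- The total derivative `D_t` of a function of `(t, x, u)`. -/
noncomputable def totalDt (f : Pt → ℝ) (z : Jet) : ℝ :=
  fderiv ℝ f z.base ![1, 0, z 3]

/-- The `∂_{u_t}`-coefficient of the prolongation of `Q`. -/
noncomputable def prolongT (Q : Pt → Pt) (z : Jet) : ℝ :=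
  totalDt (fun p => Q p 2) z - z 3 * totalDt (fun p => Q p 0) z
    - z 4 * totalDt (fun p => Q p 1) z

/-- The `∂_{u_x}`-coefficient of the prolongation of `Q`. -/
noncomputable def prolongX (Q : Pt → Pt) (z : Jet) : ℝ :=
  totalDx (fun y => Q y.base 2) z - z 3 * totalDx (fun y => Q y.base 0) z
    - z 4 * totalDx (fun y => Q y.base 1) z

/-- The `∂_{u_xx}`-coefficient of the prolongation of `Q`. -/
noncomputable def prolongXX (Q : Pt → Pt) (z : Jet) : ℝ :=
  totalDx (prolongX Q) z - z 5 * totalDx (fun y => Q y.base 0) z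
    - z 6 * totalDx (fun y => Q y.base 1) z

/-- The `∂_{u_xxx}`-coefficient of the prolongation of `Q`. -/
noncomputable def prolongXXX (Q : Pt → Pt) (z : Jet) : ℝ :=
  totalDx (prolongXX Q) z - z 7 * totalDx (fun y => Q y.base 0) z
    - z 8 * totalDx (fun y => Q y.base 1) z

/-- `Q` is an infinitesimal point symmetry of `u_t = F u_xxx + G`, where `F` and `G` are functions
on `N`: the third prolongation of `Q` annihilates `u_t - F u_xxx - G` on the solution
manifold of the equation. -/
def IsSymmetry (N : Set EqPt) (F G : EqPt → ℝ) (Q : Pt → Pt) : Prop :=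
  ∀ z : Jet, z.eqPt ∈ N → z 3 = F z.eqPt * z 8 + G z.eqPt →
    let Q' : EqPt := ![Q z.base 0, Q z.base 1, Q z.base 2, prolongX Q z, prolongXX Q z]
    prolongT Q z
      - (fderiv ℝ F z.eqPt Q' * z 8 + F z.eqPt * prolongXXX Q z + fderiv ℝ G z.eqPt Q') = 0

/-- A set `S` of vector fields on `M` is admissible if all its members are symmetries of one and
the same third-order evolution equation `u_t = F u_xxx + G` over `M`, where `F` and `G` are
smooth on an open set `N` of points `(t, x, u, u_x, u_xx)` lying over `M`, and `F ≠ 0` in the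
sense that `F` vanishes identically on no nonempty open part of `N`. -/
def IsAdmissible (M : Set Pt) (S : Set (Pt → Pt)) : Prop :=
  ∃ (N : Set EqPt) (F G : EqPt → ℝ), IsOpen N ∧ EqPt.base '' N = M ∧
    ContDiffOn ℝ ∞ F N ∧ ContDiffOn ℝ ∞ G N ∧
    (∀ W ⊆ N, IsOpen W → W.Nonempty → ∃ q ∈ W, F q ≠ 0) ∧
    ∀ Q ∈ S, IsSymmetry N F G Q

/-! ### Representations of `so(3, ℝ)` on spaces of vector fields -/

/-- `B` is mapped to itself by the adjoint action of the realization of `so(3, ℝ)`. -/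
def IsSo3Invariant (M : Set Pt) (B : Submodule ℝ (Pt → Pt)) : Prop :=
  ∀ i, ∀ V ∈ B, VectorField.lieBracket ℝ (so3Field M i) V ∈ B

/-- `A` is a finite-dimensional abelian Lie algebra of smooth vector fields on `M` on which the
realization of `so(3, ℝ)` acts irreducibly by the adjoint action. -/
structure IsAbelianIrrep (M : Set Pt) (A : Submodule ℝ (Pt → Pt)) : Prop where
  smooth : A ≤ smoothFields M
  finite : FiniteDimensional ℝ A
  abelian : ∀ V ∈ A, ∀ W ∈ A, VectorField.lieBracket ℝ V W = 0
  invariant : IsSo3Invariant M A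
  ne_bot : A ≠ ⊥
  irreducible : ∀ B ≤ A, IsSo3Invariant M B → B = ⊥ ∨ B = A

/-- The domains of `(t, x, u)` considered: nonempty connected open sets whose time slices are
connected and on which `cos u ≠ 0`, so that the realization of `so(3, ℝ)` is smooth. -/
structure IsSo3Domain (M : Set Pt) : Prop where
  isOpen : IsOpen M
  isConnected : IsConnected M
  slice : ∀ t : ℝ, IsPreconnected (M ∩ {p | p 0 = t})
  cos_ne_zero : ∀ p ∈ M, Real.cos (p 2) ≠ 0

/-! ### Equivalence -/

/-- `Φ` restricts to an element `t' = T(t), x' = X(t, x, u), u' = U(t, x, u)` of the equivalence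
group of evolution equations on the open set `M`: a smooth invertible transformation, with
smooth inverse, of `M` onto an open set. -/
structure IsEquivTransf (M : Set Pt) (Φ : Pt → Pt) : Prop where
  smooth : ContDiffOn ℝ ∞ Φ M
  injOn : Set.InjOn Φ M
  bijective_fderiv : ∀ p ∈ M, Function.Bijective (fderiv ℝ Φ p)
  time : ∃ T : ℝ → ℝ, ∀ p ∈ M, Φ p 0 = T (p 0)

/-- `Φ` maps the vector field `V` on `M` to the vector field `V'` on `Φ(M)`. -/
def MapsField (M : Set Pt) (Φ V V' : Pt → Pt) : Prop :=
  ∀ p ∈ M, fderiv ℝ Φ p (V p) = V' (Φ p)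

/-- The spaces of vector fields `A` on `M` and `A'` on `M'` are equivalent representation spaces
of the realization of `so(3, ℝ)`: a transformation `M → M'` in the equivalence group preserves
the form of each of `e₁, e₂, e₃` and maps `A` onto `A'`. -/
def So3Equivalent (M : Set Pt) (A : Submodule ℝ (Pt → Pt))
    (M' : Set Pt) (A' : Submodule ℝ (Pt → Pt)) : Prop :=
  ∃ Φ : Pt → Pt, IsEquivTransf M Φ ∧ Φ '' M = M' ∧
    (∀ i, MapsField M Φ (so3Field M i) (so3Field M' i)) ∧
    (∀ V ∈ A, ∃ V' ∈ A', MapsField M Φ V V') ∧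
    (∀ V' ∈ A', ∃ V ∈ A, MapsField M Φ V V')

end EvolSym

/-! Read x and u as longitude and latitude on the unit sphere: the `so3Field` are then the
infinitesimal rotations. The classification excludes purely vertical spaces, then uses the symmetry
condition to make the rotation action trivial.

Vertical spaces. Some nonzero element J of so(3) vanishes at a given point p, so its bracket with a
field V has a value at p that depends on V(p) alone (`isotropy_apply`). On vertical values its
square is -(1 + tan² u), which is -|J|². Let A be abelian, irreducible and without ∂_t-components,
and let V(p) ≠ 0. Then V(p) and (JV)(p) span the vertical plane, and commutativity makes the fields
of A vanishing at p an invariant subspace, hence zero. So A embeds into its values at p, and J² =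
-|J|² holds on A. The eigenvalues of J would be ±i|J|, at distance 2|J|, while generators orthogonal
to J shift eigenvalues by ±i|J|; hence they act as zero, and so does J (`so3_rep_rotate`), a
contradiction.

Symmetries. The equation does not involve u_txx, and ζ^xxx contains it with coefficient -3 D_x τ,
where τ is the time component. Hence F D_x τ = 0, and τ depends locally only on t
(`IsSymmetry.fderiv_time`). Brackets with rotations then have no time component; they lie in the
vertical part of A, which is a proper invariant subspace and so zero. Thus A is a line spanned by a
field commuting with so(3), which must be a(t) ∂_t. The determining equation (aF)_t = 0 makes the
zero set of a open, so a has no zeros on the connected M, and T' = 1/a straightens the field. Only A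
has to consist of symmetries here, not the rotations.

Existence. A geometric flow of curves on the sphere is invariant under rotations and time shifts:
normal velocity equal to the arclength derivative of the logarithm of geodesic curvature
(`isSymmetry_so3Comb`). -/

open Topology Filter VectorField

namespace EvolSym

/-! ### The realization of `so(3, ℝ)` -/

/-- The formulas for `e₁, e₂, e₃`, without the restriction to a domain. -/
noncomputable def so3Fun : Fin 3 → Pt → Pt :=
  ![fun _ => ![0, 1, 0],
    fun p => ![0, Real.tan (p 2) * Real.sin (p 1), Real.cos (p 1)],
    fun p => ![0, Real.tan (p 2) * Real.cos (p 1), -Real.sin (p 1)]]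

/-- The differentials of `e₁, e₂, e₃` at `p`. -/
noncomputable def so3Deriv (p v : Pt) : Fin 3 → Pt :=
  ![0,
    ![0, (1 + Real.tan (p 2) ^ 2) * v 2 * Real.sin (p 1)
        + Real.tan (p 2) * (Real.cos (p 1) * v 1), -(Real.sin (p 1) * v 1)],
    ![0, (1 + Real.tan (p 2) ^ 2) * v 2 * Real.cos (p 1)
        - Real.tan (p 2) * (Real.sin (p 1) * v 1), -(Real.cos (p 1) * v 1)]]

lemma so3Field_eq_indicator (M : Set Pt) (i : Fin 3) :
    so3Field M i = M.indicator (so3Fun i) := by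
  fin_cases i <;> rfl

lemma so3Field_of_mem {M : Set Pt} {p : Pt} (hp : p ∈ M) (i : Fin 3) :
    so3Field M i p = so3Fun i p := by
  rw [so3Field_eq_indicator, Set.indicator_of_mem hp]

lemma so3Field_of_notMem {M : Set Pt} {p : Pt} (hp : p ∉ M) (i : Fin 3) :
    so3Field M i p = 0 := by
  rw [so3Field_eq_indicator, Set.indicator_of_notMem hp]

lemma so3Field_eventuallyEq {M : Set Pt} (hM : IsOpen M) {p : Pt} (hp : p ∈ M) (i : Fin 3) :
    so3Field M i =ᶠ[𝓝 p] so3Fun i := by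
  filter_upwards [hM.mem_nhds hp] with q hq using so3Field_of_mem hq i

lemma hasDerivAt_tan' {x : ℝ} (hx : Real.cos x ≠ 0) :
    HasDerivAt Real.tan (1 + Real.tan x ^ 2) x := by
  have := Real.hasDerivAt_tan hx
  rwa [one_div, ← inv_pow, inv_pow, ← Real.inv_one_add_tan_sq hx, inv_inv] at this

lemma contDiffAt_so3Fun {p : Pt} (hp : Real.cos (p 2) ≠ 0) (i : Fin 3) :
    ContDiffAt ℝ ∞ (so3Fun i) p := by
  have htan : ContDiffAt ℝ ∞ (fun q : Pt => Real.tan (q 2)) p :=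
    ContDiffAt.comp (g := Real.tan) (f := fun q : Pt => q 2) p (Real.contDiffAt_tan.2 hp)
      (contDiff_apply ℝ ℝ (2 : Fin 3)).contDiffAt
  have h1 : ContDiffAt ℝ ∞ (fun q : Pt => q 1) p := (contDiff_apply ℝ ℝ (1 : Fin 3)).contDiffAt
  suffices h : ∀ j, ContDiffAt ℝ ∞ (fun q => so3Fun i q j) p from contDiffAt_pi' h
  intro j
  fin_cases i <;> fin_cases j <;> simp [so3Fun] <;> first | exact contDiffAt_const | fun_prop

lemma fderiv_so3Fun {p : Pt} (hp : Real.cos (p 2) ≠ 0) (v : Pt) (i : Fin 3) :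
    fderiv ℝ (so3Fun i) p v = so3Deriv p v i := by
  have hd := (contDiffAt_so3Fun hp i).differentiableAt (by simp)
  have h1 : HasFDerivAt (fun q : Pt => q 1) (ContinuousLinearMap.proj (1 : Fin 3)) p :=
    (ContinuousLinearMap.proj (R := ℝ) (φ := fun _ : Fin 3 => ℝ) 1).hasFDerivAt
  have h2 : HasFDerivAt (fun q : Pt => q 2) (ContinuousLinearMap.proj (2 : Fin 3)) p :=
    (ContinuousLinearMap.proj (R := ℝ) (φ := fun _ : Fin 3 => ℝ) 2).hasFDerivAt
  have ht : HasFDerivAt (fun q : Pt => Real.tan (q 2))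
      ((1 + Real.tan (p 2) ^ 2) • ContinuousLinearMap.proj (2 : Fin 3)) p :=
    HasDerivAt.comp_hasFDerivAt (h₂ := Real.tan) (f := fun q : Pt => q 2) p (hasDerivAt_tan' hp) h2
  ext j
  have key : fderiv ℝ (so3Fun i) p v j = fderiv ℝ (fun q => so3Fun i q j) p v := by
    rw [fderiv_apply hd]; rfl
  rw [key]
  fin_cases i <;> fin_cases j <;> simp [so3Fun, so3Deriv]
  · rw [(ht.fun_mul h1.sin).fderiv]; simp; ring
  · rw [h1.cos.fderiv]; simp
  · rw [(ht.fun_mul h1.cos).fderiv]; simp; ring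
  · rw [h1.sin.fderiv]; simp

/-! ### Brackets of smooth fields and the adjoint representation. -/

lemma contDiffAt_of_mem_smoothFields {M : Set Pt} (hM : IsOpen M) {V : Pt → Pt}
    (hV : V ∈ smoothFields M) {p : Pt} (hp : p ∈ M) : ContDiffAt ℝ ∞ V p :=
  hV.1.contDiffAt (hM.mem_nhds hp)

lemma differentiableAt_of_mem_smoothFields {M : Set Pt} (hM : IsOpen M) {V : Pt → Pt}
    (hV : V ∈ smoothFields M) {p : Pt} (hp : p ∈ M) : DifferentiableAt ℝ V p :=
  (contDiffAt_of_mem_smoothFields hM hV hp).differentiableAt (by simp)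

lemma so3Field_mem_smoothFields {M : Set Pt} (hM : IsSo3Domain M) (i : Fin 3) :
    so3Field M i ∈ smoothFields M :=
  ⟨fun p hp => ((contDiffAt_so3Fun (hM.cos_ne_zero p hp) i).congr_of_eventuallyEq
    (so3Field_eventuallyEq hM.isOpen hp i)).contDiffWithinAt,
    fun _ hp => so3Field_of_notMem hp i⟩

lemma lieBracket_apply_of_notMem {M : Set Pt} {V W : Pt → Pt} (hV : V ∈ smoothFields M)
    (hW : W ∈ smoothFields M) {p : Pt} (hp : p ∉ M) : lieBracket ℝ V W p = 0 :=
  lieBracket_eq_zero_of_eq_zero (hV.2 p hp) (hW.2 p hp)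

lemma lieBracket_mem_smoothFields {M : Set Pt} (hM : IsOpen M) {V W : Pt → Pt}
    (hV : V ∈ smoothFields M) (hW : W ∈ smoothFields M) :
    lieBracket ℝ V W ∈ smoothFields M :=
  ⟨fun _ hp => (ContDiffAt.lieBracket_vectorField (contDiffAt_of_mem_smoothFields hM hV hp)
    (contDiffAt_of_mem_smoothFields hM hW hp) le_rfl).contDiffWithinAt,
    fun _ hp => lieBracket_apply_of_notMem hV hW hp⟩

lemma lieBracket_so3Field_apply {M : Set Pt} (hM : IsSo3Domain M) (V : Pt → Pt)
    {p : Pt} (hp : p ∈ M) (i : Fin 3) :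
    lieBracket ℝ (so3Field M i) V p
      = fderiv ℝ V p (so3Fun i p) - so3Deriv p (V p) i := by
  rw [lieBracket_eq]
  simp only
  rw [so3Field_of_mem hp, (so3Field_eventuallyEq hM.isOpen hp i).fderiv_eq,
    fderiv_so3Fun (hM.cos_ne_zero p hp)]

/-- The commutation relations `[e₁, e₂] = e₃`, `[e₂, e₃] = e₁`, `[e₃, e₁] = e₂`. -/
lemma lieBracket_so3Field {M : Set Pt} (hM : IsSo3Domain M) :
    lieBracket ℝ (so3Field M 0) (so3Field M 1) = so3Field M 2 ∧
    lieBracket ℝ (so3Field M 1) (so3Field M 2) = so3Field M 0 ∧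
    lieBracket ℝ (so3Field M 2) (so3Field M 0) = so3Field M 1 := by
  refine ⟨?_, ?_, ?_⟩ <;>
  · ext p j
    by_cases hp : p ∈ M
    · rw [lieBracket_so3Field_apply hM _ hp, (so3Field_eventuallyEq hM.isOpen hp _).fderiv_eq,
        fderiv_so3Fun (hM.cos_ne_zero p hp), so3Field_of_mem hp, so3Field_of_mem hp]
      have := Real.sin_sq_add_cos_sq (p 1)
      fin_cases j <;> simp [so3Fun, so3Deriv]
      all_goals first | done | linear_combination this | ring
    · rw [lieBracket_apply_of_notMem (so3Field_mem_smoothFields hM _)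
        (so3Field_mem_smoothFields hM _) hp, so3Field_of_notMem hp]

lemma leibniz_of_mem_smoothFields {M : Set Pt} (hM : IsOpen M) {U V W : Pt → Pt}
    (hU : U ∈ smoothFields M) (hV : V ∈ smoothFields M) (hW : W ∈ smoothFields M) :
    lieBracket ℝ U (lieBracket ℝ V W)
      = lieBracket ℝ (lieBracket ℝ U V) W + lieBracket ℝ V (lieBracket ℝ U W) := by
  ext1 p
  by_cases hp : p ∈ M
  · exact leibniz_identity_lieBracket (n := ∞)
      (by rw [minSmoothness_of_isRCLikeNormedField]; exact WithTop.coe_le_coe.2 le_top)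
      (contDiffAt_of_mem_smoothFields hM hU hp) (contDiffAt_of_mem_smoothFields hM hV hp)
      (contDiffAt_of_mem_smoothFields hM hW hp)
  · have hb {V W} (hV : V ∈ smoothFields M) (hW : W ∈ smoothFields M) :=
      lieBracket_mem_smoothFields hM hV hW
    rw [Pi.add_apply, lieBracket_apply_of_notMem hU (hb hV hW) hp,
      lieBracket_apply_of_notMem (hb hU hV) hW hp,
      lieBracket_apply_of_notMem hV (hb hU hW) hp, add_zero]

/-- The adjoint action of `e₁, e₂, e₃` on an invariant space of smooth fields. -/
noncomputable def so3Ad {M : Set Pt} (hM : IsOpen M) {A : Submodule ℝ (Pt → Pt)}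
    (hA : A ≤ smoothFields M) (hinv : IsSo3Invariant M A) (hs : ∀ i, so3Field M i ∈ smoothFields M)
    (i : Fin 3) : Module.End ℝ A where
  toFun V := ⟨lieBracket ℝ (so3Field M i) V, hinv i V V.2⟩
  map_add' V W := by
    ext1
    ext1 p
    by_cases hp : p ∈ M
    · exact lieBracket_add_right (differentiableAt_of_mem_smoothFields hM (hA V.2) hp)
        (differentiableAt_of_mem_smoothFields hM (hA W.2) hp)
    · have h0 (U : A) := lieBracket_apply_of_notMem (hs i) (hA U.2) hp
      simp only [Submodule.coe_add, Pi.add_apply]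
      rw [h0 V, h0 W, ← Submodule.coe_add, h0 (V + W), add_zero]
  map_smul' r V := by
    ext1
    ext1 p
    by_cases hp : p ∈ M
    · exact lieBracket_const_smul_right (differentiableAt_of_mem_smoothFields hM (hA V.2) hp)
    · have h0 (U : A) := lieBracket_apply_of_notMem (hs i) (hA U.2) hp
      simp only [Submodule.coe_smul, Pi.smul_apply, RingHom.id_apply]
      rw [h0 V, ← Submodule.coe_smul, h0 (r • V), smul_zero]

/-- The Jacobi identity makes the adjoint action a representation. The commutator is written without
subtraction so that it can serve as a rewriting rule for products. -/
lemma so3Ad_comm {M : Set Pt} (hM : IsSo3Domain M) {A : Submodule ℝ (Pt → Pt)}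
    (hA : A ≤ smoothFields M) (hinv : IsSo3Invariant M A) (hs : ∀ i, so3Field M i ∈ smoothFields M)
    {i j k : Fin 3} (h : lieBracket ℝ (so3Field M i) (so3Field M j) = so3Field M k) :
    so3Ad hM.isOpen hA hinv hs i * so3Ad hM.isOpen hA hinv hs j
      = so3Ad hM.isOpen hA hinv hs k + so3Ad hM.isOpen hA hinv hs j * so3Ad hM.isOpen hA hinv hs i := by
  ext1 V
  ext1
  have := leibniz_of_mem_smoothFields hM.isOpen (hs i) (hs j) (hA V.2)
  rw [h] at this
  exact this

/-- A representation of `so(3)` in which a nonzero element `J` satisfies `J² = -|J|²` does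
not exist. -/
lemma so3_rep_eq_zero {R : Type*} [Ring R] [Algebra ℝ R] {E₁ E₂ E₃ : R}
    (h12 : E₁ * E₂ = E₃ + E₂ * E₁) (h23 : E₂ * E₃ = E₁ + E₃ * E₂) (h31 : E₃ * E₁ = E₂ + E₁ * E₃)
    {τ : ℝ} {J : R} (hJ : J = E₃ - τ • E₁) (hJ2 : J * J = -(1 + τ ^ 2) • (1 : R)) : J = 0 := by
  have hN : J * E₂ - E₂ * J = -E₁ - τ • E₃ := by
    rw [hJ]
    simp only [mul_sub, sub_mul, smul_mul_assoc, mul_smul_comm, h12, h23]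
    module
  have hNN : J * (-E₁ - τ • E₃) - (-E₁ - τ • E₃) * J = -(1 + τ ^ 2) • E₂ := by
    rw [hJ]
    simp only [mul_sub, sub_mul, mul_neg, neg_mul, smul_mul_assoc, mul_smul_comm, h31]
    module
  set σ : ℝ := 1 + τ ^ 2 with hσ
  have hσ0 : σ ≠ 0 := by positivity
  -- `E₂` is orthogonal to `J`, so [J, [J, E₂]] = -σ E₂. Expanding with J² = -σ leaves 2 J E₂ J = -σ
  -- E₂. Then J² E₂ J² equals both σ² E₂ and (σ²/4) E₂, which forces E₂ = 0.
  have h1 : (2 : ℝ) • (J * E₂ * J) = -σ • E₂ := by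
    have h : J * (-E₁ - τ • E₃) - (-E₁ - τ • E₃) * J
        = J * J * E₂ - (2 : ℝ) • (J * E₂ * J) + E₂ * (J * J) := by
      rw [← hN, two_smul]
      noncomm_ring
    rw [hNN, hJ2, smul_mul_assoc, mul_smul_comm, one_mul, mul_one] at h
    linear_combination (norm := module) h
  have h2 : (2 : ℝ) • (J * (J * E₂ * J) * J) = (2 * σ ^ 2) • E₂ := by
    have h : J * (J * E₂ * J) * J = J * J * E₂ * (J * J) := by noncomm_ring
    rw [h, hJ2, smul_mul_assoc, mul_smul_comm, smul_mul_assoc, one_mul, mul_one]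
    module
  have h3 : (2 : ℝ) • (J * (J * E₂ * J) * J) = (σ ^ 2 / 2) • E₂ := by
    have h : (2 : ℝ) • (J * (J * E₂ * J) * J) = J * ((2 : ℝ) • (J * E₂ * J)) * J := by
      simp only [mul_smul_comm, smul_mul_assoc]
    rw [h, h1, mul_smul_comm, smul_mul_assoc]
    have h4 : J * E₂ * J = (-σ / 2) • E₂ := by
      linear_combination (norm := module) (1 / 2 : ℝ) • h1
    rw [h4]
    module
  have hE : E₂ = 0 := by
    have : (3 / 2 * σ ^ 2) • E₂ = 0 := by
      linear_combination (norm := module) h3 - h2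
    exact (smul_eq_zero.1 this).resolve_left (by positivity)
  rw [hE] at h12 h23
  simp only [mul_zero, zero_mul, add_zero] at h12 h23
  rw [hJ, ← h12, ← h23, smul_zero, sub_zero]

/-- A rotation of the generators about the first axis. -/
lemma so3_rep_rotate {R : Type*} [Ring R] [Algebra ℝ R] {E₁ E₂ E₃ : R}
    (h12 : E₁ * E₂ = E₃ + E₂ * E₁) (h23 : E₂ * E₃ = E₁ + E₃ * E₂) (h31 : E₃ * E₁ = E₂ + E₁ * E₃)
    {τ s c : ℝ} (hsc : s ^ 2 + c ^ 2 = 1) {J : R} (hJ : J = s • E₂ + c • E₃ - τ • E₁)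
    (hJ2 : J * J = -(1 + τ ^ 2) • (1 : R)) : J = 0 := by
  refine so3_rep_eq_zero (E₁ := E₁) (E₂ := c • E₂ - s • E₃) (E₃ := s • E₂ + c • E₃)
    ?_ ?_ ?_ hJ hJ2
  · simp only [mul_sub, sub_mul, smul_mul_assoc, mul_smul_comm, h12, h31]
    module
  · have hE : E₁ = (s ^ 2 + c ^ 2) • E₁ := by rw [hsc, one_smul]
    rw [hE]
    simp only [mul_add, add_mul, mul_sub, sub_mul, smul_mul_assoc, mul_smul_comm, h23]
    module
  · simp only [mul_add, add_mul, smul_mul_assoc, mul_smul_comm, h12, h31]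
    module

/-! ### Vertical representation spaces -/

/-- The combination `sin x₀ e₂ + cos x₀ e₃ - tan u₀ e₁` of the generators which vanishes at
`p = (t₀, x₀, u₀)` acts on the values of vector fields at `p`. -/
lemma isotropy_apply {M : Set Pt} (hM : IsSo3Domain M) (V : Pt → Pt) {p : Pt} (hp : p ∈ M) :
    Real.sin (p 1) • lieBracket ℝ (so3Field M 1) V p
      + Real.cos (p 1) • lieBracket ℝ (so3Field M 2) V p
      - Real.tan (p 2) • lieBracket ℝ (so3Field M 0) V p
      = ![0, -((1 + Real.tan (p 2) ^ 2) * V p 2), V p 1] := by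
  simp only [lieBracket_so3Field_apply hM V hp]
  -- The combination vanishes at `p`, so the terms that differentiate `V` cancel.
  have hk : Real.sin (p 1) • so3Fun 1 p + Real.cos (p 1) • so3Fun 2 p
      - Real.tan (p 2) • so3Fun 0 p = 0 := by
    ext j
    have := Real.sin_sq_add_cos_sq (p 1)
    fin_cases j <;> simp [so3Fun]
    · linear_combination Real.tan (p 2) * this
    · ring
  have hd := congrArg (fderiv ℝ V p) hk
  simp only [map_add, map_sub, map_smul, map_zero] at hd
  have hs : Real.sin (p 1) • so3Deriv p (V p) 1 + Real.cos (p 1) • so3Deriv p (V p) 2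
      - Real.tan (p 2) • so3Deriv p (V p) 0
      = -![0, -((1 + Real.tan (p 2) ^ 2) * V p 2), V p 1] := by
    ext j
    have := Real.sin_sq_add_cos_sq (p 1)
    fin_cases j <;> simp [so3Deriv]
    · linear_combination (1 + Real.tan (p 2) ^ 2) * V p 2 * this
    · linear_combination -V p 1 * this
  linear_combination (norm := module) hd - hs

/-- A field commuting with `e₁, e₂, e₃` has no `∂_x`- and `∂_u`-components. -/
lemma eq_zero_of_lieBracket_so3Field_eq_zero {M : Set Pt} (hM : IsSo3Domain M) {V : Pt → Pt}
    (hV : ∀ i, lieBracket ℝ (so3Field M i) V = 0) {p : Pt} (hp : p ∈ M) : V p 1 = 0 ∧ V p 2 = 0 := by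
  have h := isotropy_apply hM V hp
  simp only [hV, Pi.zero_apply, smul_zero, add_zero, sub_zero] at h
  have h1 := congrFun h 1
  have h2 := congrFun h 2
  simp at h1 h2
  refine ⟨h2.symm, h1.resolve_left (by positivity)⟩

/-- There are no abelian irreducible representation spaces of vertical fields. -/
lemma IsAbelianIrrep.exists_time_ne_zero {M : Set Pt} (hM : IsSo3Domain M)
    {A : Submodule ℝ (Pt → Pt)} (hA : IsAbelianIrrep M A) : ∃ V ∈ A, ∃ p, V p 0 ≠ 0 := by
  by_contra! hvert
  obtain ⟨V, hVA, hV0⟩ := A.exists_mem_ne_zero_of_ne_bot hA.ne_bot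
  obtain ⟨p, hVp⟩ := Function.ne_iff.1 hV0
  have hp : p ∈ M := by
    by_contra hp
    exact hVp ((hA.smooth hVA).2 p hp)
  have hs := so3Field_mem_smoothFields hM
  set E := so3Ad hM.isOpen hA.smooth hA.invariant hs with hE
  set τ := Real.tan (p 2)
  set J : Module.End ℝ A := Real.sin (p 1) • E 1 + Real.cos (p 1) • E 2 - τ • E 0 with hJ
  have hJp (W : A) : (J W : Pt → Pt) p = ![0, -((1 + τ ^ 2) * (W : Pt → Pt) p 2),
      (W : Pt → Pt) p 1] := isotropy_apply hM W hp
  set b := V p 1 with hb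
  set c := V p 2 with hc
  have hdet : b ^ 2 + (1 + τ ^ 2) * c ^ 2 ≠ 0 := by
    intro h
    have hb0 : b = 0 := by nlinarith [sq_nonneg b, sq_nonneg c, mul_nonneg (sq_nonneg τ) (sq_nonneg c)]
    have hc0 : c = 0 := by nlinarith [sq_nonneg b, sq_nonneg c, mul_nonneg (sq_nonneg τ) (sq_nonneg c)]
    refine hVp ?_
    ext j
    fin_cases j
    · exact hvert V hVA p
    · exact hb0
    · exact hc0
  -- Evaluation at `p` is injective on `A`: its kernel is invariant, and it is proper because `V p ≠
  -- 0`.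
  have hker : A ⊓ LinearMap.ker (LinearMap.proj (R := ℝ) (φ := fun _ : Pt => Pt) p) = ⊥ := by
    refine (hA.irreducible _ inf_le_left ?_).resolve_right ?_
    · rintro i W ⟨hWA, hWp⟩
      have hWp : W p = 0 := hWp
      refine ⟨hA.invariant i W hWA, ?_⟩
      -- Since `W p = 0`, the bracket [U, W] at `p` is just the derivative of `W` along `U p`.
      have hcomm (U : Pt → Pt) (hU : U ∈ A) : fderiv ℝ W p (U p) = 0 := by
        have := congrFun (hA.abelian U hU W hWA) p
        rw [lieBracket_eq] at this
        simpa [hWp] using this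
      have h1 := hcomm V hVA
      have h2 := hcomm _ (J ⟨V, hVA⟩).2
      rw [hJp] at h2
      -- Cramer's rule in the basis `V p`, `(J V) p` of the vertical plane, whose determinant is the
      -- number in `hdet`.
      have hspan : so3Fun i p = ((b * so3Fun i p 1 + (1 + τ ^ 2) * c * so3Fun i p 2)
            / (b ^ 2 + (1 + τ ^ 2) * c ^ 2)) • V p
          + ((b * so3Fun i p 2 - c * so3Fun i p 1) / (b ^ 2 + (1 + τ ^ 2) * c ^ 2))
            • ![0, -((1 + τ ^ 2) * V p 2), V p 1] := by
        ext j
        fin_cases j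
        · have : so3Fun i p 0 = 0 := by fin_cases i <;> simp [so3Fun]
          simp [this, hvert V hVA p]
        · simp [← hb, ← hc]
          field_simp
          ring
        · simp [← hb, ← hc]
          field_simp
          ring
      change lieBracket ℝ (so3Field M i) W p = 0
      rw [lieBracket_so3Field_apply hM W hp, hspan, map_add, map_smul, map_smul, h1, h2, hWp]
      ext j
      fin_cases i <;> fin_cases j <;> simp [so3Deriv]
    · intro h
      exact hVp (h.ge hVA).2
  have hinj (W : A) (hW : (W : Pt → Pt) p = 0) : W = 0 := by
    have : (W : Pt → Pt) ∈ (⊥ : Submodule ℝ (Pt → Pt)) := hker ▸ ⟨W.2, hW⟩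
    exact Subtype.ext this
  have hJ2 : J * J = -(1 + τ ^ 2) • (1 : Module.End ℝ A) := by
    ext1 W
    rw [← sub_eq_zero]
    refine hinj _ ?_
    change (J (J W) : Pt → Pt) p - (-(1 + τ ^ 2)) • (W : Pt → Pt) p = 0
    rw [hJp, hJp]
    ext j
    fin_cases j
    · simp [hvert W W.2 p]
    · simp
      ring
    · simp
      ring
  obtain ⟨h12, h23, h31⟩ := lieBracket_so3Field hM
  have hJ0 : J = 0 := so3_rep_rotate (R := Module.End ℝ A)
    (E₁ := E 0) (E₂ := E 1) (E₃ := E 2)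
    (so3Ad_comm hM hA.smooth hA.invariant hs h12) (so3Ad_comm hM hA.smooth hA.invariant hs h23)
    (so3Ad_comm hM hA.smooth hA.invariant hs h31) (Real.sin_sq_add_cos_sq (p 1)) hJ hJ2
  have h0 := hJp ⟨V, hVA⟩
  rw [hJ0] at h0
  have h1 := congrFun h0 1
  have h2 := congrFun h0 2
  simp at h1 h2
  refine hdet ?_
  rw [hb, hc, ← h2, h1.resolve_left (by positivity)]
  simp

/-! ### The time component of a symmetry -/

/-- The projection `Jet.base` as a continuous linear map. -/
noncomputable def Jet.baseL : Jet →L[ℝ] Pt :=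
  ContinuousLinearMap.pi ![ContinuousLinearMap.proj 0, ContinuousLinearMap.proj 1,
    ContinuousLinearMap.proj 2]

lemma Jet.base_eq : Jet.base = Jet.baseL := by
  ext z i
  fin_cases i <;> rfl

/-- The projection `EqPt.base` as a continuous linear map. -/
noncomputable def EqPt.baseL : EqPt →L[ℝ] Pt :=
  ContinuousLinearMap.pi ![ContinuousLinearMap.proj 0, ContinuousLinearMap.proj 1,
    ContinuousLinearMap.proj 2]

lemma EqPt.base_eq : EqPt.base = EqPt.baseL := by
  ext z i
  fin_cases i <;> rfl

/-- The direction of the total derivative `D_x`. -/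
def Jet.dxVec (z : Jet) : Jet := ![0, 1, z 4, z 5, z 6, z 7, z 8, 0, 0]

lemma totalDx_eq (f : Jet → ℝ) (z : Jet) : totalDx f z = fderiv ℝ f z z.dxVec := rfl

lemma isOpen_jet_over {M : Set Pt} (hM : IsOpen M) : IsOpen {z : Jet | z.base ∈ M} := by
  rw [Jet.base_eq]
  exact hM.preimage Jet.baseL.continuous

lemma contDiffOn_totalDx {U : Set Jet} (hU : IsOpen U) {f : Jet → ℝ} (hf : ContDiffOn ℝ ∞ f U) :
    ContDiffOn ℝ ∞ (totalDx f) U := by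
  have hv : ContDiff ℝ ∞ Jet.dxVec := by
    refine contDiff_pi' fun i => ?_
    fin_cases i <;> simp only [Jet.dxVec] <;> first | exact contDiff_const | exact contDiff_apply ℝ ℝ _
  exact (hf.fderiv_of_isOpen hU (by simp)).clm_apply hv.contDiffOn

lemma contDiffOn_coeff {M : Set Pt} {Q : Pt → Pt} (hQ : ContDiffOn ℝ ∞ Q M) (i : Fin 3) :
    ContDiffOn ℝ ∞ (fun y : Jet => Q y.base i) {z : Jet | z.base ∈ M} := by
  rw [Jet.base_eq]
  exact ((contDiff_apply ℝ ℝ i).comp_contDiffOn hQ).comp Jet.baseL.contDiff.contDiffOn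
    fun _ hz => hz

lemma contDiffOn_prolongX {M : Set Pt} (hM : IsOpen M) {Q : Pt → Pt} (hQ : ContDiffOn ℝ ∞ Q M) :
    ContDiffOn ℝ ∞ (prolongX Q) {z : Jet | z.base ∈ M} := by
  have h i := contDiffOn_totalDx (isOpen_jet_over hM) (contDiffOn_coeff hQ i)
  exact ((h 2).sub ((contDiff_apply ℝ ℝ (3 : Fin 9)).contDiffOn.mul (h 0))).sub
    ((contDiff_apply ℝ ℝ (4 : Fin 9)).contDiffOn.mul (h 1))

lemma contDiffOn_prolongXX {M : Set Pt} (hM : IsOpen M) {Q : Pt → Pt} (hQ : ContDiffOn ℝ ∞ Q M) :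
    ContDiffOn ℝ ∞ (prolongXX Q) {z : Jet | z.base ∈ M} := by
  have h i := contDiffOn_totalDx (isOpen_jet_over hM) (contDiffOn_coeff hQ i)
  exact ((contDiffOn_totalDx (isOpen_jet_over hM) (contDiffOn_prolongX hM hQ)).sub
    ((contDiff_apply ℝ ℝ (5 : Fin 9)).contDiffOn.mul (h 0))).sub
    ((contDiff_apply ℝ ℝ (6 : Fin 9)).contDiffOn.mul (h 1))

/-! ### How the prolongation coefficients depend on u_t, u_tx and u_txx. -/

section Lines

variable {E : Type*} [NormedAddCommGroup E] [NormedSpace ℝ E]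

lemma fderiv_apply_of_affine {f : E → ℝ} {z v : E} {k : ℝ} (hf : DifferentiableAt ℝ f z)
    (h : ∀ s : ℝ, f (z + s • v) = f z + s * k) : fderiv ℝ f z v = k := by
  have h1 : HasDerivAt (fun s : ℝ => f (z + s • v)) (fderiv ℝ f z v) 0 :=
    hf.hasFDerivAt.hasLineDerivAt v
  have h2 : HasDerivAt (fun s : ℝ => f (z + s • v)) k 0 := by
    simp only [h]
    simpa using ((hasDerivAt_id (0 : ℝ)).mul_const k).const_add (f z)
  exact h1.unique h2

/-- Differentiability is not needed: elsewhere `fderiv` has the default value 0. -/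
lemma fderiv_apply_of_invariant {f : E → ℝ} {z v : E} (h : ∀ s : ℝ, f (z + s • v) = f z) :
    fderiv ℝ f z v = 0 := by
  by_cases hf : DifferentiableAt ℝ f z
  · exact fderiv_apply_of_affine hf fun s => by rw [h, mul_zero, add_zero]
  · simp [fderiv_zero_of_not_differentiableAt hf]

lemma fderiv_add_smul_of_invariant {f : E → ℝ} {v : E} (h : ∀ (y : E) (s : ℝ), f (y + s • v) = f y)
    (z : E) (s : ℝ) : fderiv ℝ f (z + s • v) = fderiv ℝ f z := by
  rw [← fderiv_comp_add_right]
  simp only [h]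

end Lines

/-- The slope is the commutator of ∂_v with D_x, a derivation along the constant vector `w`; it
equals ∂_v D_x f because ∂_v f = 0. The next three lemmas give it for u_t (zero), u_tx (∂_{u_t}) and
u_txx (∂_{u_tx}). -/
lemma totalDx_add_smul {f : Jet → ℝ} {v w : Jet} (h : ∀ (y : Jet) (s : ℝ), f (y + s • v) = f y)
    (hw : ∀ (y : Jet) (s : ℝ), (y + s • v).dxVec = y.dxVec + s • w) (z : Jet) (s : ℝ) :
    totalDx f (z + s • v) = totalDx f z + s * fderiv ℝ f z w := by
  rw [totalDx_eq, totalDx_eq, fderiv_add_smul_of_invariant h, hw, map_add, map_smul, smul_eq_mul]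

lemma dxVec_add_smul_three (y : Jet) (s : ℝ) :
    (y + s • (Pi.single 3 1 : Jet)).dxVec = y.dxVec + s • (0 : Jet) := by
  ext i
  fin_cases i <;> simp [Jet.dxVec]

lemma dxVec_add_smul_five (y : Jet) (s : ℝ) :
    (y + s • (Pi.single 5 1 : Jet)).dxVec = y.dxVec + s • (Pi.single 3 1 : Jet) := by
  ext i
  fin_cases i <;> simp [Jet.dxVec]

lemma dxVec_add_smul_seven (y : Jet) (s : ℝ) :
    (y + s • (Pi.single 7 1 : Jet)).dxVec = y.dxVec + s • (Pi.single 5 1 : Jet) := by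
  ext i
  fin_cases i <;> simp [Jet.dxVec]

lemma base_add_smul_single (z : Jet) (s : ℝ) {j : Fin 9} (hj : 2 < j) :
    (z + s • (Pi.single j 1 : Jet)).base = z.base := by
  have h0 : (0 : Fin 9) ≠ j := by omega
  have h1 : (1 : Fin 9) ≠ j := by omega
  have h2 : (2 : Fin 9) ≠ j := by omega
  ext i
  fin_cases i <;> simp [Jet.base, h0, h1, h2]

lemma coeff_add_smul_single (Q : Pt → Pt) (z : Jet) (s : ℝ) (i : Fin 3) {j : Fin 9} (hj : 2 < j) :
    Q (z + s • (Pi.single j 1 : Jet)).base i = Q z.base i := by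
  rw [base_add_smul_single z s hj]

lemma fderiv_coeff_single (Q : Pt → Pt) (z : Jet) (i : Fin 3) {j : Fin 9} (hj : 2 < j) :
    fderiv ℝ (fun y : Jet => Q y.base i) z (Pi.single j 1) = 0 :=
  fderiv_apply_of_invariant fun s => coeff_add_smul_single Q z s i hj

lemma totalDx_coeff_add_smul_three (Q : Pt → Pt) (z : Jet) (s : ℝ) (i : Fin 3) :
    totalDx (fun y : Jet => Q y.base i) (z + s • (Pi.single 3 1 : Jet))
      = totalDx (fun y : Jet => Q y.base i) z := by
  rw [totalDx_add_smul (fun y s => coeff_add_smul_single Q y s i (by decide))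
    dxVec_add_smul_three, map_zero, mul_zero, add_zero]

lemma totalDx_coeff_add_smul_five (Q : Pt → Pt) (z : Jet) (s : ℝ) (i : Fin 3) :
    totalDx (fun y : Jet => Q y.base i) (z + s • (Pi.single 5 1 : Jet))
      = totalDx (fun y : Jet => Q y.base i) z := by
  rw [totalDx_add_smul (fun y s => coeff_add_smul_single Q y s i (by decide))
    dxVec_add_smul_five, fderiv_coeff_single Q z i (by decide), mul_zero, add_zero]

lemma totalDx_coeff_add_smul_seven (Q : Pt → Pt) (z : Jet) (s : ℝ) (i : Fin 3) :
    totalDx (fun y : Jet => Q y.base i) (z + s • (Pi.single 7 1 : Jet))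
      = totalDx (fun y : Jet => Q y.base i) z := by
  rw [totalDx_add_smul (fun y s => coeff_add_smul_single Q y s i (by decide))
    dxVec_add_smul_seven, fderiv_coeff_single Q z i (by decide), mul_zero, add_zero]

lemma prolongX_add_smul_three (Q : Pt → Pt) (z : Jet) (s : ℝ) :
    prolongX Q (z + s • (Pi.single 3 1 : Jet))
    = prolongX Q z + s * -totalDx (fun y => Q y.base 0) z := by
  simp only [prolongX, totalDx_coeff_add_smul_three]
  simp
  ring

lemma prolongX_add_smul_five (Q : Pt → Pt) (z : Jet) (s : ℝ) :
    prolongX Q (z + s • (Pi.single 5 1 : Jet)) = prolongX Q z := by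
  simp only [prolongX, totalDx_coeff_add_smul_five]
  simp

lemma prolongX_add_smul_seven (Q : Pt → Pt) (z : Jet) (s : ℝ) :
    prolongX Q (z + s • (Pi.single 7 1 : Jet)) = prolongX Q z := by
  simp only [prolongX, totalDx_coeff_add_smul_seven]
  simp

lemma prolongXX_add_smul_seven (Q : Pt → Pt) (z : Jet) (s : ℝ) :
    prolongXX Q (z + s • (Pi.single 7 1 : Jet)) = prolongXX Q z := by
  simp only [prolongXX, totalDx_coeff_add_smul_seven]
  rw [totalDx_add_smul (prolongX_add_smul_seven Q) dxVec_add_smul_seven,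
    fderiv_apply_of_invariant (prolongX_add_smul_five Q z)]
  simp

lemma prolongT_add_smul_seven (Q : Pt → Pt) (z : Jet) (s : ℝ) :
    prolongT Q (z + s • (Pi.single 7 1 : Jet)) = prolongT Q z := by
  simp only [prolongT, totalDt, base_add_smul_single z s (show (2 : Fin 9) < 7 by decide)]
  simp

lemma prolongXX_add_smul_five {M : Set Pt} (hM : IsOpen M) {Q : Pt → Pt}
    (hQ : ContDiffOn ℝ ∞ Q M) {z : Jet} (hz : z.base ∈ M) (s : ℝ) :
    prolongXX Q (z + s • (Pi.single 5 1 : Jet))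
    = prolongXX Q z + s * (-2 * totalDx (fun y => Q y.base 0) z) := by
  have hd : DifferentiableAt ℝ (prolongX Q) z :=
    ((contDiffOn_prolongX hM hQ).contDiffAt ((isOpen_jet_over hM).mem_nhds hz)).differentiableAt
      (by simp)
  simp only [prolongXX, totalDx_coeff_add_smul_five]
  rw [totalDx_add_smul (prolongX_add_smul_five Q) dxVec_add_smul_five,
    fderiv_apply_of_affine hd fun s => prolongX_add_smul_three Q z s]
  simp
  ring

/-- The coefficient climbs from -1 for u_t in ζ^x to -2 for u_tx in ζ^xx and -3 for u_txx in ζ^xxx: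
each D_x passes it on, and the explicit correction term of the recursion adds one more. -/
lemma prolongXXX_add_smul_seven {M : Set Pt} (hM : IsOpen M) {Q : Pt → Pt}
    (hQ : ContDiffOn ℝ ∞ Q M) {z : Jet} (hz : z.base ∈ M) (s : ℝ) :
    prolongXXX Q (z + s • (Pi.single 7 1 : Jet))
    = prolongXXX Q z + s * (-3 * totalDx (fun y => Q y.base 0) z) := by
  have hd : DifferentiableAt ℝ (prolongXX Q) z :=
    ((contDiffOn_prolongXX hM hQ).contDiffAt ((isOpen_jet_over hM).mem_nhds hz)).differentiableAt
      (by simp)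
  simp only [prolongXXX, totalDx_coeff_add_smul_seven]
  rw [totalDx_add_smul (prolongXX_add_smul_seven Q) dxVec_add_smul_seven,
    fderiv_apply_of_affine hd fun s => prolongXX_add_smul_five hM hQ hz s]
  simp
  ring

lemma totalDx_coeff {Q : Pt → Pt} {z : Jet} (hQ : DifferentiableAt ℝ Q z.base) (i : Fin 3) :
    totalDx (fun y => Q y.base i) z = fderiv ℝ Q z.base ![0, 1, z 4] i := by
  have h1 : HasFDerivAt (fun y : Jet => Q y.base)
      ((fderiv ℝ Q z.base).comp Jet.baseL) z := by
    have : HasFDerivAt Jet.base Jet.baseL z := by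
      rw [Jet.base_eq]
      exact Jet.baseL.hasFDerivAt
    exact hQ.hasFDerivAt.comp z this
  have h2 : HasFDerivAt (fun y : Jet => Q y.base i) _ z := (hasFDerivAt_pi'.1 h1) i
  rw [totalDx_eq, h2.fderiv]
  have : Jet.baseL z.dxVec = ![0, 1, z 4] := by
    rw [← Jet.base_eq]
    rfl
  simp [this]

/-- A jet over a given point of `(t, x, u, u_x, u_xx)`-space and with given `u_xxx` on the solution
manifold of `u_t = f u_xxx + g`. -/
def solutionJet (q : EqPt) (f g r : ℝ) : Jet := ![q 0, q 1, q 2, f * r + g, q 3, 0, q 4, 0, r]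

lemma solutionJet_eqPt (q : EqPt) (f g r : ℝ) : (solutionJet q f g r).eqPt = q := by
  ext i
  fin_cases i <;> rfl

lemma solutionJet_base (q : EqPt) (f g r : ℝ) : (solutionJet q f g r).base = q.base := by
  ext i
  fin_cases i <;> rfl

/-- A continuous function annihilated by a function `F` which is nonzero on a dense set vanishes. -/
lemma eq_zero_of_mul_eq_zero {X : Type*} [TopologicalSpace X] {N : Set X} (hN : IsOpen N)
    {F g : X → ℝ} (hF : ∀ W ⊆ N, IsOpen W → W.Nonempty → ∃ q ∈ W, F q ≠ 0)
    (hg : ContinuousOn g N) (h : ∀ q ∈ N, F q * g q = 0) {q : X} (hq : q ∈ N) : g q = 0 := by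
  by_contra hne
  obtain ⟨r, ⟨hrN, hr⟩, hFr⟩ := hF (N ∩ g ⁻¹' {0}ᶜ) Set.inter_subset_left
    (hg.isOpen_inter_preimage hN isOpen_compl_singleton) ⟨q, hq, hne⟩
  exact (mul_ne_zero hFr hr) (h r hrN)

/-- The time component of a symmetry of an evolution equation of order three depends only on
`t`. -/
lemma IsSymmetry.fderiv_time {M : Set Pt} (hM : IsOpen M) {N : Set EqPt} {F G : EqPt → ℝ}
    (hN : IsOpen N) (hNM : EqPt.base '' N = M)
    (hF : ∀ W ⊆ N, IsOpen W → W.Nonempty → ∃ q ∈ W, F q ≠ 0) {Q : Pt → Pt}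
    (hQ : ContDiffOn ℝ ∞ Q M) (hsym : IsSymmetry N F G Q) {p v : Pt} (hp : p ∈ M) (hv : v 0 = 0) :
    fderiv ℝ Q p v 0 = 0 := by
  have hbase {q : EqPt} (hq : q ∈ N) : q.base ∈ M := hNM ▸ Set.mem_image_of_mem _ hq
  have hDx {q : EqPt} (hq : q ∈ N) : fderiv ℝ Q q.base ![0, 1, q 3] 0 = 0 := by
    refine eq_zero_of_mul_eq_zero (g := fun q => fderiv ℝ Q q.base ![0, 1, q 3] 0) hN hF ?_ ?_ hq
    · have h1 : ContinuousOn (fun q : EqPt => fderiv ℝ Q q.base) N := by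
        rw [EqPt.base_eq] at hbase ⊢
        exact (hQ.continuousOn_fderiv_of_isOpen hM (by simp)).comp
          EqPt.baseL.continuous.continuousOn fun q hq => hbase hq
      have h2 : Continuous fun q : EqPt => (![0, 1, q 3] : Pt) := by
        refine continuous_pi fun i => ?_
        fin_cases i <;> simp <;> fun_prop
      exact (continuous_apply 0).comp_continuousOn (h1.clm_apply h2.continuousOn)
    · intro q hq
      set z := solutionJet q (F q) (G q) 0 with hz
      have hzq : z.eqPt = q := solutionJet_eqPt ..
      have hzb : z.base ∈ M := solutionJet_base q (F q) (G q) 0 ▸ hbase hq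
      have hz3 : z 3 = F z.eqPt * z 8 + G z.eqPt := by
        rw [hzq]
        rfl
      -- Raising u_txx by 1 stays on the solution manifold; subtracting the two symmetry conditions
      -- leaves F · D_x τ = 0.
      have he : (z + (1 : ℝ) • (Pi.single 7 1 : Jet)).eqPt = z.eqPt := by
        ext i
        fin_cases i <;> simp [Jet.eqPt]
      have hb := base_add_smul_single z 1 (show (2 : Fin 9) < 7 by decide)
      have h1 := hsym z (hzq ▸ hq) hz3
      have h2 := hsym (z + (1 : ℝ) • (Pi.single 7 1 : Jet)) (by rw [he, hzq]; exact hq)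
        (by rw [he]; simpa using hz3)
      simp only [he, hb, prolongX_add_smul_seven, prolongXX_add_smul_seven,
        prolongT_add_smul_seven, prolongXXX_add_smul_seven hM hQ hzb 1] at h1 h2
      have h8 : (z + (1 : ℝ) • (Pi.single 7 1 : Jet)) 8 = z 8 := by simp
      rw [h8] at h2
      have h3 : F z.eqPt * totalDx (fun y => Q y.base 0) z = 0 := by linarith
      rw [hzq, totalDx_coeff ((hQ.contDiffAt (hM.mem_nhds hzb)).differentiableAt (by simp))] at h3
      exact h3
  obtain ⟨q, hq, rfl⟩ := (hNM ▸ hp : p ∈ EqPt.base '' N)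
  -- D_x τ = τ_x + u_x τ_u vanishes for two different values of u_x over the same point, because `N`
  -- is open; hence τ_x = τ_u = 0.
  have hcont : Continuous fun s : ℝ => q + s • (Pi.single 3 1 : EqPt) := by fun_prop
  obtain ⟨ε, hε, hball⟩ := Metric.isOpen_iff.1 (hN.preimage hcont) 0 (by simpa using hq)
  have hε2 : q + (ε / 2) • (Pi.single 3 1 : EqPt) ∈ N :=
    hball (by rw [Metric.mem_ball, dist_zero_right, Real.norm_of_nonneg (by positivity)]; linarith)
  have h1 := hDx hq
  have h2 := hDx hε2
  have hb : (q + (ε / 2) • (Pi.single 3 1 : EqPt)).base = q.base := by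
    ext i
    fin_cases i <;> simp [EqPt.base]
  rw [hb] at h2
  have hv' : v = v 1 • ![0, 1, q 3] + ((v 2 - v 1 * q 3) / (ε / 2)) •
      (![0, 1, (q + (ε / 2) • (Pi.single 3 1 : EqPt)) 3] - ![0, 1, q 3]) := by
    ext i
    fin_cases i
    · simp [hv]
    · simp
    · simp
      field_simp
      ring
  rw [hv', map_add, map_smul, map_smul, map_sub]
  rw [Pi.add_apply, Pi.smul_apply, Pi.smul_apply, Pi.sub_apply, h1, h2]
  simp

/-! ### Symmetries of the form `a(t) ∂_t` -/

lemma isConst_of_fderiv_zero_of_ball {Q : Pt → Pt} {p : Pt} {r : ℝ}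
    (hd : ∀ q ∈ Metric.ball p r, DifferentiableAt ℝ Q q)
    (h : ∀ q ∈ Metric.ball p r, ∀ v : Pt, v 0 = 0 → fderiv ℝ Q q v 0 = 0) {q q' : Pt}
    (hq : q ∈ Metric.ball p r) (hq' : q' ∈ Metric.ball p r) (h0 : q 0 = q' 0) :
    Q q 0 = Q q' 0 := by
  have hL : Continuous (AffineMap.lineMap q q' : ℝ → Pt) := AffineMap.lineMap_continuous
  have hderiv : ∀ s ∈ (AffineMap.lineMap q q' : ℝ → Pt) ⁻¹' Metric.ball p r,
      HasDerivAt (fun s : ℝ => Q (AffineMap.lineMap q q' s) 0) 0 s := by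
    intro s hs
    have h1 : HasDerivAt (fun s : ℝ => Q (AffineMap.lineMap q q' s)) _ s :=
      (hd _ hs).hasFDerivAt.comp_hasDerivAt s AffineMap.hasDerivAt_lineMap
    have h2 := (hasDerivAt_pi.1 h1) 0
    rwa [h _ hs _ (by simp [h0])] at h2
  have hconv : Convex ℝ ((AffineMap.lineMap q q' : ℝ → Pt) ⁻¹' Metric.ball p r) :=
    (convex_ball p r).affine_preimage _
  have := (Metric.isOpen_ball.preimage hL).is_const_of_deriv_eq_zero hconv.isPreconnected
    (fun s hs => (hderiv s hs).differentiableAt.differentiableWithinAt)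
    (fun s hs => (hderiv s hs).deriv) (x := 0) (y := 1) (by simpa using hq) (by simpa using hq')
  simpa using this

/-- The time component is locally constant on each slice; connectedness of the slices turns this
into a global function of t. -/
lemma time_eq_of_slice {M : Set Pt} (hM : IsSo3Domain M) {Q : Pt → Pt}
    (hQ : ContDiffOn ℝ ∞ Q M)
    (h : ∀ q ∈ M, ∀ v : Pt, v 0 = 0 → fderiv ℝ Q q v 0 = 0) {q q' : Pt}
    (hq : q ∈ M) (hq' : q' ∈ M) (h0 : q 0 = q' 0) : Q q 0 = Q q' 0 := by
  have hpre := isPreconnected_iff_preconnectedSpace.1 (hM.slice (q' 0))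
  have hlc : IsLocallyConstant fun y : ↥(M ∩ {p | p 0 = q' 0}) => Q y 0 := by
    refine (IsLocallyConstant.iff_eventually_eq _).2 fun y => ?_
    obtain ⟨r, hr, hball⟩ := Metric.isOpen_iff.1 hM.isOpen y y.2.1
    have hmem : Subtype.val ⁻¹' Metric.ball (y : Pt) r ∈ 𝓝 y :=
      continuous_subtype_val.continuousAt.preimage_mem_nhds (Metric.ball_mem_nhds _ hr)
    filter_upwards [hmem] with y' hy'
    refine isConst_of_fderiv_zero_of_ball
      (fun q hq => (hQ.contDiffAt (hM.isOpen.mem_nhds (hball hq))).differentiableAt (by simp))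
      (fun q hq => h q (hball hq)) hy' (Metric.mem_ball_self hr) (y'.2.2.trans y.2.2.symm)
  exact hlc.apply_eq_of_preconnectedSpace ⟨q, hq, h0⟩ ⟨q', hq', rfl⟩

lemma fderiv_coeff {Q : Pt → Pt} {p : Pt} (hQ : DifferentiableAt ℝ Q p) (i : Fin 3) (v : Pt) :
    fderiv ℝ (fun q => Q q i) p v = fderiv ℝ Q p v i := by
  rw [fderiv_apply hQ]
  rfl

/-- The determining equation `(a F)_t = 0` for a symmetry `a(t) ∂_t`. -/
lemma IsSymmetry.time_field {M : Set Pt} (hM : IsOpen M) {N : Set EqPt} {F G : EqPt → ℝ}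
    (hNM : EqPt.base '' N = M) {Q : Pt → Pt} (hQ : ContDiffOn ℝ ∞ Q M)
    (hsym : IsSymmetry N F G Q) (h : ∀ q ∈ M, ∀ v : Pt, v 0 = 0 → fderiv ℝ Q q v 0 = 0)
    (h12 : ∀ p ∈ M, Q p 1 = 0 ∧ Q p 2 = 0) {q : EqPt} (hq : q ∈ N) :
    fderiv ℝ Q q.base (Pi.single 0 1) 0 * F q
      + Q q.base 0 * fderiv ℝ F q (Pi.single 0 1) = 0 := by
  have hbase : q.base ∈ M := hNM ▸ Set.mem_image_of_mem _ hq
  have hd {p : Pt} (hp : p ∈ M) : DifferentiableAt ℝ Q p :=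
    (hQ.contDiffAt (hM.mem_nhds hp)).differentiableAt (by simp)
  have hder {p : Pt} (hp : p ∈ M) (v : Pt) : fderiv ℝ Q p v 1 = 0 ∧ fderiv ℝ Q p v 2 = 0 := by
    rw [← fderiv_coeff (hd hp), ← fderiv_coeff (hd hp)]
    have h1 : (fun p => Q p 1) =ᶠ[𝓝 p] fun _ => 0 := by
      filter_upwards [hM.mem_nhds hp] with p hp using (h12 p hp).1
    have h2 : (fun p => Q p 2) =ᶠ[𝓝 p] fun _ => 0 := by
      filter_upwards [hM.mem_nhds hp] with p hp using (h12 p hp).2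
    rw [h1.fderiv_eq, h2.fderiv_eq]
    simp
  have hDx {z : Jet} (hz : z.base ∈ M) (i : Fin 3) : totalDx (fun y => Q y.base i) z = 0 := by
    rw [totalDx_coeff (hd hz)]
    fin_cases i
    · exact h _ hz _ rfl
    · exact (hder hz _).1
    · exact (hder hz _).2
  have hDx0 {f : Jet → ℝ} (hf : ∀ z : Jet, z.base ∈ M → f z = 0) (z : Jet) (hz : z.base ∈ M) :
      totalDx f z = 0 := by
    have : f =ᶠ[𝓝 z] fun _ => 0 := by
      filter_upwards [(isOpen_jet_over hM).mem_nhds hz] with y hy using hf y hy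
    rw [totalDx_eq, this.fderiv_eq]
    simp
  have hX : ∀ z : Jet, z.base ∈ M → prolongX Q z = 0 := fun z hz => by
    simp [prolongX, hDx hz]
  have hXX : ∀ z : Jet, z.base ∈ M → prolongXX Q z = 0 := fun z hz => by
    simp [prolongXX, hDx hz, hDx0 hX z hz]
  have hXXX : ∀ z : Jet, z.base ∈ M → prolongXXX Q z = 0 := fun z hz => by
    simp [prolongXXX, hDx hz, hDx0 hXX z hz]
  have hT : ∀ z : Jet, z.base ∈ M →
      prolongT Q z = -(z 3 * fderiv ℝ Q z.base (Pi.single 0 1) 0) := fun z hz => by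
    have hv : (![1, 0, z 3] : Pt) = Pi.single 0 1 + ![0, 0, z 3] := by
      ext i
      fin_cases i <;> simp
    simp only [prolongT, totalDt]
    rw [fderiv_coeff (hd hz), fderiv_coeff (hd hz), fderiv_coeff (hd hz), (hder hz _).1,
      (hder hz _).2, hv, map_add, Pi.add_apply, h _ hz ![0, 0, z 3] rfl]
    ring
  have key (r : ℝ) := hsym (solutionJet q (F q) (G q) r)
    (by rw [solutionJet_eqPt]; exact hq) (by rw [solutionJet_eqPt]; rfl)
  simp only [solutionJet_eqPt] at key
  have hzb (r : ℝ) : (solutionJet q (F q) (G q) r).base = q.base := solutionJet_base ..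
  have hzM (r : ℝ) : (solutionJet q (F q) (G q) r).base ∈ M := hzb r ▸ hbase
  have hQ' : (![Q q.base 0, Q q.base 1, Q q.base 2, 0, 0] : EqPt)
      = Q q.base 0 • (Pi.single 0 1 : EqPt) := by
    ext i
    fin_cases i <;> simp [(h12 _ hbase).1, (h12 _ hbase).2]
  have key' (r : ℝ) : (F q * r + G q) * fderiv ℝ Q q.base (Pi.single 0 1) 0
      + (Q q.base 0 * fderiv ℝ F q (Pi.single 0 1) * r
      + Q q.base 0 * fderiv ℝ G q (Pi.single 0 1)) = 0 := by
    have := key r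
    rw [hX _ (hzM r), hXX _ (hzM r), hXXX _ (hzM r), hT _ (hzM r), hzb, hQ'] at this
    simp only [map_smul, smul_eq_mul] at this
    have h3 : solutionJet q (F q) (G q) r 3 = F q * r + G q := rfl
    have h8 : solutionJet q (F q) (G q) r 8 = r := rfl
    rw [h3, h8] at this
    linarith
  -- The condition is affine in u_xxx, so its leading coefficient is the difference of its values at
  -- 1 and 0.
  linear_combination key' 1 - key' 0

/-- By (aF)_t = 0 the product aF is constant along t-lines. If a vanishes at one time, aF vanishes
on a whole ball, and so does a because F is nonzero on a dense set. -/
lemma isOpen_zeros_of_isSymmetry {M : Set Pt} (hM : IsOpen M) {N : Set EqPt} {F G : EqPt → ℝ}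
    (hN : IsOpen N) (hNM : EqPt.base '' N = M) (hFs : ContDiffOn ℝ ∞ F N)
    (hF : ∀ W ⊆ N, IsOpen W → W.Nonempty → ∃ q ∈ W, F q ≠ 0)
    {Q : Pt → Pt} (hQ : ContDiffOn ℝ ∞ Q M)
    (hsym : IsSymmetry N F G Q) (h : ∀ q ∈ M, ∀ v : Pt, v 0 = 0 → fderiv ℝ Q q v 0 = 0)
    (h12 : ∀ p ∈ M, Q p 1 = 0 ∧ Q p 2 = 0) : IsOpen {p ∈ M | Q p 0 = 0} := by
  refine Metric.isOpen_iff.2 ?_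
  rintro p ⟨hp, hp0⟩
  obtain ⟨q, hq, rfl⟩ := (hNM ▸ hp : p ∈ EqPt.base '' N)
  obtain ⟨r, hr, hball⟩ := Metric.isOpen_iff.1 hN q hq
  have hd {p : Pt} (hp : p ∈ M) : DifferentiableAt ℝ Q p :=
    (hQ.contDiffAt (hM.mem_nhds hp)).differentiableAt (by simp)
  have hbase {q' : EqPt} (hq' : q' ∈ N) : q'.base ∈ M := hNM ▸ Set.mem_image_of_mem _ hq'
  -- Balls for the sup metric are boxes, so they are compatible with projecting, lifting and
  -- changing one coordinate.
  have hdown {q' : EqPt} (hq' : q' ∈ Metric.ball q r) : q'.base ∈ Metric.ball q.base r := by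
    rw [Metric.mem_ball, dist_pi_lt_iff hr] at hq' ⊢
    intro i
    fin_cases i
    · exact hq' 0
    · exact hq' 1
    · exact hq' 2
  have hlift {p' : Pt} (hp' : p' ∈ Metric.ball q.base r) :
      (![p' 0, p' 1, p' 2, q 3, q 4] : EqPt) ∈ Metric.ball q r := by
    rw [Metric.mem_ball, dist_pi_lt_iff hr] at hp' ⊢
    intro i
    fin_cases i
    · exact hp' 0
    · exact hp' 1
    · exact hp' 2
    · simpa using hr
    · simpa using hr
  have hlift_base (p' : Pt) : EqPt.base ![p' 0, p' 1, p' 2, q 3, q 4] = p' := by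
    ext i
    fin_cases i <;> rfl
  have hballM : Metric.ball q.base r ⊆ M := fun p' hp' =>
    hlift_base p' ▸ hbase (hball (hlift hp'))
  have hupd {q' : EqPt} (hq' : q' ∈ Metric.ball q r) {s : ℝ} (hs : s ∈ Metric.ball (q 0) r) :
      Function.update q' 0 s ∈ Metric.ball q r := by
    rw [Metric.mem_ball, dist_pi_lt_iff hr] at hq' ⊢
    intro i
    by_cases hi : i = 0
    · subst hi
      simpa using hs
    · rw [Function.update_of_ne hi]
      exact hq' i
  have hFQ : ∀ q' ∈ Metric.ball q r, F q' * Q q'.base 0 = 0 := by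
    intro q' hq'
    have hderiv : ∀ s ∈ Metric.ball (q 0) r, HasDerivAt
        (fun s => F (Function.update q' 0 s) * Q (EqPt.base (Function.update q' 0 s)) 0) 0 s := by
      intro s hs
      have hmem := hball (hupd hq' hs)
      have h1 : HasDerivAt (fun s => F (Function.update q' 0 s)) _ s :=
        ((hFs.contDiffAt (hN.mem_nhds hmem)).differentiableAt
          (by simp)).hasFDerivAt.comp_hasDerivAt s (hasDerivAt_update q' 0 s)
      have hb : HasDerivAt (fun s => (EqPt.base (Function.update q' 0 s))) (Pi.single 0 1) s := by
        have hb' : (fun s => (EqPt.base (Function.update q' 0 s))) = Function.update q'.base 0 := by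
          ext s i
          fin_cases i <;> rfl
        rw [hb']
        exact hasDerivAt_update q'.base 0 s
      have h2 : HasDerivAt (fun s => Q (EqPt.base (Function.update q' 0 s))) _ s :=
        (hd (hbase hmem)).hasFDerivAt.comp_hasDerivAt s hb
      have h3 := h1.fun_mul (hasDerivAt_pi.1 h2 0)
      have h4 := hsym.time_field hM hNM hQ h h12 hmem
      exact h3.congr_deriv (by linear_combination h4)
    have hconst := Metric.isOpen_ball.is_const_of_deriv_eq_zero
      (convex_ball (q 0) r).isPreconnected
      (fun s hs => (hderiv s hs).differentiableAt.differentiableWithinAt)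
      (fun s hs => (hderiv s hs).deriv) (x := q' 0) (y := q 0)
      ((dist_pi_lt_iff hr).1 hq' 0) (Metric.mem_ball_self hr)
    simp only [Function.update_eq_self] at hconst
    rw [hconst]
    have hz := isConst_of_fderiv_zero_of_ball (fun q hq => hd (hballM hq))
      (fun q hq => h q (hballM hq)) (hdown (hupd hq' (Metric.mem_ball_self hr)))
      (Metric.mem_ball_self hr) (by simp [EqPt.base])
    rw [hz, hp0, mul_zero]
  refine ⟨r, hr, fun p' hp' => ⟨hballM hp', ?_⟩⟩
  have hcont : ContinuousOn (fun q' : EqPt => Q q'.base 0) (Metric.ball q r) := by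
    intro q' hq'
    have hb : ContinuousAt EqPt.base q' := by
      rw [EqPt.base_eq]
      exact EqPt.baseL.continuous.continuousAt
    exact ((continuous_apply 0).continuousAt.comp
      (ContinuousAt.comp (hd (hballM (hdown hq'))).continuousAt hb)).continuousWithinAt
  have := eq_zero_of_mul_eq_zero Metric.isOpen_ball
    (fun W hW => hF W (hW.trans hball)) hcont hFQ (hlift hp')
  rwa [hlift_base] at this

/-- An admissible abelian irreducible representation space is spanned by a field `a(t) ∂_t` with
nowhere vanishing `a`. -/
lemma IsAbelianIrrep.exists_time_field {M : Set Pt} (hM : IsSo3Domain M)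
    {A : Submodule ℝ (Pt → Pt)} (hA : IsAbelianIrrep M A)
    (hadm : IsAdmissible M (A : Set (Pt → Pt))) :
    ∃ Q, A = Submodule.span ℝ {Q} ∧ Q ≠ 0 ∧ ContDiffOn ℝ ∞ Q M ∧
      (∀ p ∈ M, Q p 0 ≠ 0 ∧ Q p 1 = 0 ∧ Q p 2 = 0) ∧
      ∀ p ∈ M, ∀ q ∈ M, p 0 = q 0 → Q p 0 = Q q 0 := by
  obtain ⟨N, F, G, hN, hNM, hFs, -, hF, hsym⟩ := hadm
  have htime (V) (hV : V ∈ A) (p) (hp : p ∈ M) (v : Pt) (hv : v 0 = 0) : fderiv ℝ V p v 0 = 0 :=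
    (hsym V hV).fderiv_time hM.isOpen hN hNM hF (hA.smooth hV).1 hp hv
  -- The rotations are vertical, and the time component of `V` has zero derivative in vertical
  -- directions.
  have hbr (V) (hV : V ∈ A) (i : Fin 3) (p : Pt) : lieBracket ℝ (so3Field M i) V p 0 = 0 := by
    by_cases hp : p ∈ M
    · rw [lieBracket_so3Field_apply hM V hp, Pi.sub_apply, htime V hV p hp]
      · fin_cases i <;> simp [so3Deriv]
      · fin_cases i <;> simp [so3Fun]
    · rw [lieBracket_apply_of_notMem (so3Field_mem_smoothFields hM i) (hA.smooth hV) hp]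
      rfl
  let ver : Submodule ℝ (Pt → Pt) :=
    { carrier := {V | ∀ p, V p 0 = 0}
      add_mem' := fun {V W} hV hW p => by simp [hV p, hW p]
      zero_mem' := fun _ => rfl
      smul_mem' := fun r V hV p => by simp [hV p] }
  have hver : A ⊓ ver = ⊥ := by
    refine (hA.irreducible _ inf_le_left ?_).resolve_right ?_
    · exact fun i V hV => ⟨hA.invariant i V hV.1, hbr V hV.1 i⟩
    · intro h
      obtain ⟨V, hV, p, hp⟩ := hA.exists_time_ne_zero hM
      exact hp ((h.ge hV).2 p)
  have hzero (V) (hV : V ∈ A) (i : Fin 3) : lieBracket ℝ (so3Field M i) V = 0 := by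
    have : lieBracket ℝ (so3Field M i) V ∈ A ⊓ ver := ⟨hA.invariant i V hV, hbr V hV i⟩
    rwa [hver] at this
  obtain ⟨Q, hQA, hQ0⟩ := A.exists_mem_ne_zero_of_ne_bot hA.ne_bot
  have hspan : Submodule.span ℝ {Q} ≤ A := (Submodule.span_singleton_le_iff_mem _ _).2 hQA
  -- The action on `A` is trivial, so every line is invariant.
  have hAQ : Submodule.span ℝ {Q} = A := by
    refine (hA.irreducible _ hspan fun i V hV => ?_).resolve_left ?_
    · rw [hzero V (hspan hV) i]
      exact Submodule.zero_mem _
    · rwa [Submodule.span_singleton_eq_bot]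
  have hQs := (hA.smooth hQA).1
  have h12 (p) (hp : p ∈ M) := eq_zero_of_lieBracket_so3Field_eq_zero hM (hzero Q hQA) hp
  have hopen := isOpen_zeros_of_isSymmetry hM.isOpen hN hNM hFs hF hQs (hsym Q hQA)
    (htime Q hQA) h12
  have hcont : ContinuousOn (fun p => Q p 0) M :=
    (continuous_apply 0).comp_continuousOn hQs.continuousOn
  have hopen' : IsOpen (M ∩ (fun p => Q p 0) ⁻¹' {0}ᶜ) :=
    hcont.isOpen_inter_preimage hM.isOpen isOpen_compl_singleton
  have hsub : M ⊆ M ∩ (fun p => Q p 0) ⁻¹' {0}ᶜ := by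
    refine hM.isConnected.isPreconnected.subset_left_of_subset_union hopen' hopen ?_ ?_ ?_
    · exact Set.disjoint_left.2 fun p hp hp' => hp.2 hp'.2
    · intro p hp
      by_cases h : Q p 0 = 0
      · exact Or.inr ⟨hp, h⟩
      · exact Or.inl ⟨hp, h⟩
    · obtain ⟨p, hp⟩ := Function.ne_iff.1 hQ0
      have hpM : p ∈ M := by
        by_contra hpM
        exact hp ((hA.smooth hQA).2 p hpM)
      refine ⟨p, hpM, hpM, fun h => hp ?_⟩
      ext i
      fin_cases i
      · exact h
      · exact (h12 p hpM).1
      · exact (h12 p hpM).2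
  exact ⟨Q, hAQ.symm, hQ0, hQs, fun p hp => ⟨(hsub hp).2, h12 p hp⟩,
    fun p hp q hq h0 => time_eq_of_slice hM hQs (htime Q hQA) hp hq h0⟩

/-! ### Straightening `a(t) ∂_t` -/

/-- A smooth nowhere vanishing function on an open interval is the reciprocal of the derivative of
a smooth injective function. -/
lemma exists_reparametrization {I : Set ℝ} (hI : IsOpen I) (hI' : I.OrdConnected)
    (hne : I.Nonempty) {α : ℝ → ℝ} (hα : ContDiffOn ℝ ∞ α I) (h0 : ∀ t ∈ I, α t ≠ 0) :
    ∃ T : ℝ → ℝ, ContDiffOn ℝ ∞ T I ∧ Set.InjOn T I ∧ ∀ t ∈ I, HasDerivAt T (α t)⁻¹ t := by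
  obtain ⟨t₀, ht₀⟩ := hne
  have hinv : ContDiffOn ℝ ∞ (fun t => (α t)⁻¹) I := hα.inv h0
  have hder : ∀ t ∈ I, HasDerivAt (fun t => ∫ s in t₀..t, (α s)⁻¹) (α t)⁻¹ t := by
    intro t ht
    refine intervalIntegral.integral_hasDerivAt_right
      (hinv.continuousOn.mono (hI'.uIcc_subset ht₀ ht)).intervalIntegrable
      (hinv.continuousOn.stronglyMeasurableAtFilter hI t ht)
      (hinv.continuousOn.continuousAt (hI.mem_nhds ht))
  refine ⟨_, ?_, ?_, hder⟩
  · rw [contDiffOn_infty_iff_deriv_of_isOpen hI]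
    exact ⟨fun t ht => (hder t ht).differentiableAt.differentiableWithinAt,
      hinv.congr fun t ht => (hder t ht).deriv⟩
  · have hlt : ∀ a ∈ I, ∀ b ∈ I, a < b →
        (∫ s in t₀..a, (α s)⁻¹) ≠ ∫ s in t₀..b, (α s)⁻¹ := by
      intro a ha b hb hab heq
      have hsub : Set.Icc a b ⊆ I := hI'.out ha hb
      -- Rolle's theorem: equal values would give a zero of 1/α.
      obtain ⟨c, hc, hc0⟩ := exists_hasDerivAt_eq_zero hab
        (fun t ht => (hder t (hsub ht)).continuousAt.continuousWithinAt) heq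
        (fun t ht => hder t (hsub (Set.Ioo_subset_Icc_self ht)))
      exact inv_ne_zero (h0 c (hsub (Set.Ioo_subset_Icc_self hc))) hc0
    intro a ha b hb heq
    rcases lt_trichotomy a b with h | h | h
    · exact absurd heq (hlt a ha b hb h)
    · exact h
    · exact absurd heq.symm (hlt b hb a ha h)

/-- The transformation `(t, x, u) ↦ (T(t), x, u)`. -/
def timeChange (T : ℝ → ℝ) (p : Pt) : Pt := ![T (p 0), p 1, p 2]

lemma hasFDerivAt_timeChange {T : ℝ → ℝ} {p : Pt} {τ : ℝ} (hT : HasDerivAt T τ (p 0)) :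
    HasFDerivAt (timeChange T) (ContinuousLinearMap.pi ![τ • ContinuousLinearMap.proj 0,
      ContinuousLinearMap.proj 1, ContinuousLinearMap.proj 2] : Pt →L[ℝ] Pt) p := by
  have hproj (i : Fin 3) : HasFDerivAt (fun p : Pt => p i)
      (ContinuousLinearMap.proj (R := ℝ) (φ := fun _ : Fin 3 => ℝ) i) p :=
    (ContinuousLinearMap.proj (R := ℝ) (φ := fun _ : Fin 3 => ℝ) i).hasFDerivAt
  refine hasFDerivAt_pi.2 fun i => ?_
  fin_cases i
  · exact HasDerivAt.comp_hasFDerivAt (h₂ := T) (f := fun q : Pt => q 0) p hT (hproj 0)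
  · exact hproj 1
  · exact hproj 2

lemma fderiv_timeChange {T : ℝ → ℝ} {p : Pt} {τ : ℝ} (hT : HasDerivAt T τ (p 0)) (v : Pt) :
    fderiv ℝ (timeChange T) p v = ![τ * v 0, v 1, v 2] := by
  rw [(hasFDerivAt_timeChange hT).fderiv]
  ext i
  fin_cases i <;> simp

/-- A domain carrying a nowhere vanishing field `a(t) ∂_t` can be transformed so that this field
becomes `∂_t`. -/
lemma exists_so3Equivalent_dtField {M : Set Pt} (hM : IsSo3Domain M) {Q : Pt → Pt}
    (hQ : ContDiffOn ℝ ∞ Q M) (hQ0 : ∀ p ∈ M, Q p 0 ≠ 0 ∧ Q p 1 = 0 ∧ Q p 2 = 0)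
    (hQt : ∀ p ∈ M, ∀ q ∈ M, p 0 = q 0 → Q p 0 = Q q 0) :
    ∃ M' : Set Pt, IsSo3Domain M' ∧
      So3Equivalent M (Submodule.span ℝ {Q}) M' (Submodule.span ℝ {dtField M'}) := by
  set I : Set ℝ := (fun p : Pt => p 0) '' M with hIdef
  have hI : IsOpen I := isOpenMap_eval 0 M hM.isOpen
  have hcI : IsConnected I := hM.isConnected.image _ (continuous_apply 0).continuousOn
  have hmemI {p : Pt} (hp : p ∈ M) : p 0 ∈ I := ⟨p, hp, rfl⟩
  choose! σ hσM hσ0 using (fun t (ht : t ∈ I) => ht)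
  set α : ℝ → ℝ := fun t => Q (σ t) 0 with hα
  have hαQ {p : Pt} (hp : p ∈ M) : α (p 0) = Q p 0 :=
    hQt _ (hσM _ (hmemI hp)) _ hp (hσ0 _ (hmemI hp))
  -- The chosen points `σ t` need not vary smoothly, but near `p 0` the value α may be computed on
  -- the t-line through `p`.
  have hαs : ContDiffOn ℝ ∞ α I := by
    rintro t ⟨p, hp, rfl⟩
    have hu : ContDiff ℝ ∞ (Function.update p 0) := contDiff_update ∞ p 0
    have hup : Function.update p 0 (p 0) = p := Function.update_eq_self 0 p
    have h1 : ContDiffAt ℝ ∞ (fun t => Q (Function.update p 0 t) 0) (p 0) := by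
      refine (contDiff_apply ℝ ℝ (0 : Fin 3)).contDiffAt.comp (p 0) ?_
      refine ContDiffAt.comp (p 0) ?_ hu.contDiffAt
      rw [hup]
      exact hQ.contDiffAt (hM.isOpen.mem_nhds hp)
    refine (h1.congr_of_eventuallyEq ?_).contDiffWithinAt
    have hnear : ∀ᶠ t in 𝓝 (p 0), Function.update p 0 t ∈ M := by
      refine hu.continuous.continuousAt.eventually_mem ?_
      rw [hup]
      exact hM.isOpen.mem_nhds hp
    filter_upwards [hnear] with t ht
    rw [← hαQ ht, Function.update_self]
  have hα0 : ∀ t ∈ I, α t ≠ 0 := fun t ht => (hQ0 _ (hσM t ht)).1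
  obtain ⟨T, hTs, hTinj, hT⟩ := exists_reparametrization hI hcI.isPreconnected.ordConnected
    hcI.nonempty hαs hα0
  have hfd {p : Pt} (hp : p ∈ M) (v : Pt) :
      fderiv ℝ (timeChange T) p v = ![(Q p 0)⁻¹ * v 0, v 1, v 2] := by
    rw [fderiv_timeChange (hT _ (hmemI hp)), hαQ hp]
  have hsmooth : ContDiffOn ℝ ∞ (timeChange T) M := by
    refine contDiffOn_pi.2 fun i => ?_
    fin_cases i
    · exact hTs.comp (contDiff_apply ℝ ℝ (0 : Fin 3)).contDiffOn fun p hp => hmemI hp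
    · exact (contDiff_apply ℝ ℝ (1 : Fin 3)).contDiffOn
    · exact (contDiff_apply ℝ ℝ (2 : Fin 3)).contDiffOn
  have hinj : Set.InjOn (timeChange T) M := by
    intro p hp q hq h
    ext i
    fin_cases i
    · exact hTinj (hmemI hp) (hmemI hq) (congrFun h 0)
    · exact congrFun h 1
    · exact congrFun h 2
  have hbij : ∀ p ∈ M, Function.Bijective (fderiv ℝ (timeChange T) p) := by
    intro p hp
    have hsurj : Function.Surjective (fderiv ℝ (timeChange T) p) := by
      intro v
      refine ⟨![Q p 0 * v 0, v 1, v 2], ?_⟩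
      rw [hfd hp]
      ext i
      have := (hQ0 p hp).1
      fin_cases i <;> simp [this]
    exact ⟨LinearMap.injective_iff_surjective.2 hsurj, hsurj⟩
  have hopen : IsOpen (timeChange T '' M) := by
    rw [isOpen_iff_mem_nhds]
    rintro _ ⟨p, hp, rfl⟩
    have hst := (hsmooth.contDiffAt (hM.isOpen.mem_nhds hp)).hasStrictFDerivAt (by simp)
    rw [← hst.map_nhds_eq_of_surj (LinearMap.range_eq_top.2 (hbij p hp).2)]
    exact image_mem_map (hM.isOpen.mem_nhds hp)
  have hcont := hsmooth.continuousOn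
  have hso3 (p : Pt) (i : Fin 3) : so3Fun i (timeChange T p) = so3Fun i p := by
    fin_cases i <;> rfl
  have hmapsQ : MapsField M (timeChange T) Q (dtField (timeChange T '' M)) := by
    intro p hp
    rw [hfd hp, dtField, Set.indicator_of_mem (Set.mem_image_of_mem _ hp), (hQ0 p hp).2.1,
      (hQ0 p hp).2.2, inv_mul_cancel₀ (hQ0 p hp).1]
  have hmaps (r : ℝ) :
      MapsField M (timeChange T) (r • Q) (r • dtField (timeChange T '' M)) := by
    intro p hp
    rw [Pi.smul_apply, map_smul, hmapsQ p hp, Pi.smul_apply]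
  refine ⟨timeChange T '' M, ⟨hopen, hM.isConnected.image _ hcont, ?_, ?_⟩,
    timeChange T, ⟨hsmooth, hinj, hbij, T, fun _ _ => rfl⟩, rfl, ?_, ?_, ?_⟩
  · intro t'
    by_cases ht : ∃ t ∈ I, T t = t'
    · obtain ⟨t, ht, rfl⟩ := ht
      have : timeChange T '' M ∩ {p | p 0 = T t} = timeChange T '' (M ∩ {p | p 0 = t}) := by
        ext q
        constructor
        · rintro ⟨⟨p, hp, rfl⟩, hpt⟩
          exact ⟨p, ⟨hp, hTinj (hmemI hp) ht hpt⟩, rfl⟩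
        · rintro ⟨p, ⟨hp, hpt⟩, rfl⟩
          exact ⟨⟨p, hp, rfl⟩, congrArg T hpt⟩
      rw [this]
      exact (hM.slice t).image _ (hcont.mono Set.inter_subset_left)
    · have : timeChange T '' M ∩ {p | p 0 = t'} = ∅ := by
        refine Set.eq_empty_of_forall_notMem ?_
        rintro _ ⟨⟨p, hp, rfl⟩, hpt⟩
        exact ht ⟨p 0, hmemI hp, hpt⟩
      rw [this]
      exact isPreconnected_empty
  · rintro _ ⟨p, hp, rfl⟩
    exact hM.cos_ne_zero p hp
  · intro i p hp
    rw [so3Field_of_mem hp, so3Field_of_mem (Set.mem_image_of_mem _ hp), hso3, hfd hp]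
    ext j
    fin_cases i <;> fin_cases j <;> simp [so3Fun]
  · intro V hV
    obtain ⟨r, rfl⟩ := Submodule.mem_span_singleton.1 hV
    exact ⟨_, Submodule.smul_mem _ r (Submodule.mem_span_singleton_self _), hmaps r⟩
  · intro V hV
    obtain ⟨r, rfl⟩ := Submodule.mem_span_singleton.1 hV
    exact ⟨_, Submodule.smul_mem _ r (Submodule.mem_span_singleton_self _), hmaps r⟩

/-! ### The representation space ⟨∂_t⟩. -/

lemma isAbelianIrrep_span_dtField {M : Set Pt} (hM : IsSo3Domain M) :
    IsAbelianIrrep M (Submodule.span ℝ {dtField M}) ∧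
      Module.finrank ℝ (Submodule.span ℝ {dtField M}) = 1 := by
  have hev {p : Pt} (hp : p ∈ M) : dtField M =ᶠ[𝓝 p] fun _ => ![1, 0, 0] := by
    filter_upwards [hM.isOpen.mem_nhds hp] with q hq using Set.indicator_of_mem hq _
  have hmem : dtField M ∈ smoothFields M :=
    ⟨fun p hp => (contDiffAt_const.congr_of_eventuallyEq (hev hp)).contDiffWithinAt,
      fun p hp => Set.indicator_of_notMem hp _⟩
  have hspan : Submodule.span ℝ {dtField M} ≤ smoothFields M :=
    (Submodule.span_singleton_le_iff_mem _ _).2 hmem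
  have hfd {p : Pt} (hp : p ∈ M) (r : ℝ) : fderiv ℝ (r • dtField M) p = 0 := by
    have h : r • dtField M =ᶠ[𝓝 p] fun _ => r • (![1, 0, 0] : Pt) := (hev hp).const_smul r
    exact h.fderiv_eq.trans (hasFDerivAt_const _ _).fderiv
  have hne : dtField M ≠ 0 := by
    obtain ⟨p, hp⟩ := hM.isConnected.nonempty
    intro h
    have := congrFun (congrFun h p) 0
    rw [dtField, Set.indicator_of_mem hp] at this
    simp at this
  have hso3 (i : Fin 3) (r : ℝ) : lieBracket ℝ (so3Field M i) (r • dtField M) = 0 := by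
    ext1 p
    by_cases hp : p ∈ M
    · rw [lieBracket_so3Field_apply hM _ hp, hfd hp]
      have : (r • dtField M) p = ![r, 0, 0] := by
        rw [Pi.smul_apply, dtField, Set.indicator_of_mem hp]
        simp
      rw [this]
      ext j
      fin_cases i <;> fin_cases j <;> simp [so3Deriv]
    · exact lieBracket_apply_of_notMem (so3Field_mem_smoothFields hM i)
        ((smoothFields M).smul_mem r hmem) hp
  refine ⟨⟨hspan, inferInstance, ?_, ?_, ?_, ?_⟩, finrank_span_singleton hne⟩
  · intro V hV W hW
    obtain ⟨r, rfl⟩ := Submodule.mem_span_singleton.1 hV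
    obtain ⟨s, rfl⟩ := Submodule.mem_span_singleton.1 hW
    ext1 p
    by_cases hp : p ∈ M
    · rw [lieBracket_eq]
      simp [hfd hp]
    · exact lieBracket_apply_of_notMem (hspan hV) (hspan hW) hp
  · intro i V hV
    obtain ⟨r, rfl⟩ := Submodule.mem_span_singleton.1 hV
    rw [hso3]
    exact Submodule.zero_mem _
  · rwa [Ne, Submodule.span_singleton_eq_bot]
  · intro B hB _
    exact ((nonzero_span_atom _ hne).le_iff).1 hB

/-! ### An equation invariant under `so(3)` and time translations -/

section DirectionalDerivatives

variable {E : Type*} [NormedAddCommGroup E] [NormedSpace ℝ E]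

/-- `f` is differentiable at `z` and its derivative in the direction `v` is `d`. -/
def HasDirDeriv (f : E → ℝ) (z v : E) (d : ℝ) : Prop :=
  DifferentiableAt ℝ f z ∧ fderiv ℝ f z v = d

variable {f g : E → ℝ} {z v : E} {d e : ℝ}

lemma HasDirDeriv.congr (hf : HasDirDeriv f z v d) (h : d = e) : HasDirDeriv f z v e :=
  h ▸ hf

lemma HasDirDeriv.add (hf : HasDirDeriv f z v d) (hg : HasDirDeriv g z v e) :
    HasDirDeriv (fun y => f y + g y) z v (d + e) :=
  ⟨hf.1.fun_add hg.1, by rw [fderiv_fun_add hf.1 hg.1, ← hf.2, ← hg.2]; rfl⟩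

lemma HasDirDeriv.sub (hf : HasDirDeriv f z v d) (hg : HasDirDeriv g z v e) :
    HasDirDeriv (fun y => f y - g y) z v (d - e) :=
  ⟨hf.1.fun_sub hg.1, by rw [fderiv_fun_sub hf.1 hg.1, ← hf.2, ← hg.2]; rfl⟩

lemma HasDirDeriv.neg (hf : HasDirDeriv f z v d) : HasDirDeriv (fun y => -f y) z v (-d) :=
  ⟨hf.1.fun_neg, by rw [fderiv_fun_neg, ← hf.2]; rfl⟩

lemma HasDirDeriv.mul (hf : HasDirDeriv f z v d) (hg : HasDirDeriv g z v e) :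
    HasDirDeriv (fun y => f y * g y) z v (d * g z + f z * e) := by
  refine ⟨hf.1.fun_mul hg.1, ?_⟩
  rw [fderiv_fun_mul hf.1 hg.1, ← hf.2, ← hg.2]
  simp only [add_apply, smul_apply, smul_eq_mul]
  ring

lemma HasDirDeriv.comp {φ : ℝ → ℝ} {φ' : ℝ} (hφ : HasDerivAt φ φ' (f z))
    (hf : HasDirDeriv f z v d) : HasDirDeriv (fun y => φ (f y)) z v (φ' * d) := by
  have h : HasFDerivAt (fun y => φ (f y)) (φ' • fderiv ℝ f z) z :=
    hφ.comp_hasFDerivAt z hf.1.hasFDerivAt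
  refine ⟨h.differentiableAt, ?_⟩
  rw [h.fderiv, ← hf.2]
  rfl

lemma HasDirDeriv.const (c : ℝ) : HasDirDeriv (fun _ : E => c) z v 0 :=
  ⟨differentiableAt_const c, by rw [(hasFDerivAt_const c z).fderiv]; rfl⟩

lemma HasDirDeriv.div (hf : HasDirDeriv f z v d) (hg : HasDirDeriv g z v e) (h0 : g z ≠ 0) :
    HasDirDeriv (fun y => f y / g y) z v (d / g z - f z * e / g z ^ 2) := by
  simp only [div_eq_mul_inv (f _)]
  refine (hf.mul (HasDirDeriv.comp (hasDerivAt_inv h0) hg)).congr ?_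
  field_simp
  ring

lemma HasDirDeriv.of_eventuallyEq (hf : HasDirDeriv f z v d) (h : g =ᶠ[𝓝 z] f) :
    HasDirDeriv g z v d :=
  ⟨hf.1.congr_of_eventuallyEq h, by rw [h.fderiv_eq (𝕜 := ℝ), hf.2]⟩

lemma hasDirDeriv_coord {n : ℕ} (z v : Fin n → ℝ) (i : Fin n) :
    HasDirDeriv (fun y : Fin n → ℝ => y i) z v (v i) := by
  have h : HasFDerivAt (fun y : Fin n → ℝ => y i)
      (ContinuousLinearMap.proj (R := ℝ) (φ := fun _ : Fin n => ℝ) i) z :=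
    (ContinuousLinearMap.proj (R := ℝ) (φ := fun _ : Fin n => ℝ) i).hasFDerivAt
  exact ⟨h.differentiableAt, by rw [h.fderiv]; rfl⟩

end DirectionalDerivatives

/-- `k ∂_t + r e₁ + s e₂ + c e₃`. -/
noncomputable def so3Comb (k r s c : ℝ) (p : Pt) : Pt :=
  ![k, r + Real.tan (p 2) * (s * Real.sin (p 1) + c * Real.cos (p 1)),
    s * Real.cos (p 1) - c * Real.sin (p 1)]

/-! ### Prolongations of the rotations and of time translations. -/

section Prolongation

variable {M : Set Pt} {Q : Pt → Pt} {k r s c : ℝ}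

/-- The restriction of `s e₂ + c e₃` to the `x`-direction, up to the factor `tan u`. -/
noncomputable def so3Phi (s c x : ℝ) : ℝ := s * Real.sin x + c * Real.cos x

/-- The `∂_u`-component of `s e₂ + c e₃`. -/
noncomputable def so3Psi (s c x : ℝ) : ℝ := s * Real.cos x - c * Real.sin x

lemma hasDerivAt_so3Phi (s c x : ℝ) : HasDerivAt (so3Phi s c) (so3Psi s c x) x := by
  refine (((Real.hasDerivAt_sin x).const_mul s).add
    ((Real.hasDerivAt_cos x).const_mul c)).congr_deriv ?_
  simp only [so3Psi]
  ring

lemma hasDerivAt_so3Psi (s c x : ℝ) : HasDerivAt (so3Psi s c) (-so3Phi s c x) x := by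
  refine (((Real.hasDerivAt_cos x).const_mul s).sub
    ((Real.hasDerivAt_sin x).const_mul c)).congr_deriv ?_
  simp only [so3Phi]
  ring

/-- The first prolongation coefficient of `so3Comb`. -/
noncomputable def so3X (s c : ℝ) (z : Jet) : ℝ :=
  -so3Phi s c (z 1) - z 4 * Real.tan (z 2) * so3Psi s c (z 1)
    - z 4 * z 4 * (1 + Real.tan (z 2) * Real.tan (z 2)) * so3Phi s c (z 1)

/-- The second prolongation coefficient of `so3Comb`. -/
noncomputable def so3XX (s c : ℝ) (z : Jet) : ℝ :=
  (z 4 * Real.tan (z 2) - 3 * z 4 * z 6 * (1 + Real.tan (z 2) * Real.tan (z 2))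
    - 2 * z 4 * z 4 * z 4 * Real.tan (z 2) * (1 + Real.tan (z 2) * Real.tan (z 2)))
      * so3Phi s c (z 1)
  - (1 + 2 * z 6 * Real.tan (z 2) + 2 * z 4 * z 4 * (1 + Real.tan (z 2) * Real.tan (z 2)))
      * so3Psi s c (z 1)

/-- The third prolongation coefficient of `so3Comb`. -/
noncomputable def so3XXX (s c : ℝ) (z : Jet) : ℝ :=
  let T := Real.tan (z 2)
  let S := 1 + T * T
  let p := z 4
  let q := z 6
  let w := z 8
  let φ := so3Phi s c (z 1)
  let ψ := so3Psi s c (z 1)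
  φ - 2 * w * T * ψ - 2 * q * S * p * ψ + 2 * q * T * φ
    - 4 * p * q * S * ψ - 4 * p ^ 3 * T * S * ψ + 2 * p ^ 2 * S * φ
    + q * T * φ + p ^ 2 * S * φ + p * T * ψ
    - 3 * q ^ 2 * S * φ - 3 * p * w * S * φ - 6 * p ^ 2 * q * T * S * φ - 3 * p * q * S * ψ
    - 6 * p ^ 2 * q * T * S * φ - 2 * p ^ 3 * (S * S + 2 * T ^ 2 * S) * p * φ
    - 2 * p ^ 3 * T * S * ψ - w * (T * ψ + S * φ * p)

section Coordinates

variable (s c) {z : Jet} (v : Jet)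

lemma hasDirDeriv_phi : HasDirDeriv (fun y : Jet => so3Phi s c (y 1)) z v
    (so3Psi s c (z 1) * v 1) :=
  HasDirDeriv.comp (hasDerivAt_so3Phi s c (z 1)) (hasDirDeriv_coord z v 1)

lemma hasDirDeriv_psi : HasDirDeriv (fun y : Jet => so3Psi s c (y 1)) z v
    (-so3Phi s c (z 1) * v 1) :=
  HasDirDeriv.comp (hasDerivAt_so3Psi s c (z 1)) (hasDirDeriv_coord z v 1)

lemma hasDirDeriv_tan (hz : Real.cos (z 2) ≠ 0) :
    HasDirDeriv (fun y : Jet => Real.tan (y 2)) z v ((1 + Real.tan (z 2) ^ 2) * v 2) :=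
  HasDirDeriv.comp (hasDerivAt_tan' hz) (hasDirDeriv_coord z v 2)

end Coordinates

lemma eventually_base_mem (hM : IsOpen M) {z : Jet} (hz : z.base ∈ M) :
    ∀ᶠ y : Jet in 𝓝 z, y.base ∈ M :=
  (isOpen_jet_over hM).mem_nhds hz

lemma totalDx_so3Comb (hM : IsSo3Domain M) (hQ : ∀ p ∈ M, Q p = so3Comb k r s c p) {z : Jet}
    (hz : z.base ∈ M) :
    totalDx (fun y => Q y.base 0) z = 0 ∧
    totalDx (fun y => Q y.base 1) z = Real.tan (z 2) * so3Psi s c (z 1)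
      + (1 + Real.tan (z 2) ^ 2) * so3Phi s c (z 1) * z 4 ∧
    totalDx (fun y => Q y.base 2) z = -so3Phi s c (z 1) := by
  have hcos : Real.cos (z 2) ≠ 0 := hM.cos_ne_zero _ hz
  have hev (i : Fin 3) : (fun y : Jet => Q y.base i) =ᶠ[𝓝 z] fun y => so3Comb k r s c y.base i := by
    filter_upwards [eventually_base_mem hM.isOpen hz] with y hy using by rw [hQ _ hy]
  refine ⟨?_, ?_, ?_⟩
  · exact ((HasDirDeriv.const k).of_eventuallyEq (hev 0)).2
  · refine (((((HasDirDeriv.const r).add ((hasDirDeriv_tan z.dxVec hcos).mul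
      (hasDirDeriv_phi s c z.dxVec))).of_eventuallyEq (hev 1)).congr ?_)).2
    have h1 : z.dxVec 1 = 1 := rfl
    have h2 : z.dxVec 2 = z 4 := rfl
    rw [h1, h2]
    ring
  · refine (((hasDirDeriv_psi s c z.dxVec).of_eventuallyEq (hev 2)).congr ?_).2
    have h1 : z.dxVec 1 = 1 := rfl
    rw [h1, mul_one]

lemma prolongX_so3Comb (hM : IsSo3Domain M) (hQ : ∀ p ∈ M, Q p = so3Comb k r s c p) {z : Jet}
    (hz : z.base ∈ M) : prolongX Q z = so3X s c z := by
  obtain ⟨h0, h1, h2⟩ := totalDx_so3Comb hM hQ hz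
  rw [prolongX, h0, h1, h2, so3X]
  ring

lemma prolongXX_so3Comb (hM : IsSo3Domain M) (hQ : ∀ p ∈ M, Q p = so3Comb k r s c p) {z : Jet}
    (hz : z.base ∈ M) : prolongXX Q z = so3XX s c z := by
  obtain ⟨h0, h1, h2⟩ := totalDx_so3Comb hM hQ hz
  have hcos : Real.cos (z 2) ≠ 0 := hM.cos_ne_zero _ hz
  have hev : prolongX Q =ᶠ[𝓝 z] so3X s c := by
    filter_upwards [eventually_base_mem hM.isOpen hz] with y hy using prolongX_so3Comb hM hQ hy
  have hT := hasDirDeriv_tan z.dxVec hcos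
  have hφ := hasDirDeriv_phi s c (z := z) z.dxVec
  have hψ := hasDirDeriv_psi s c (z := z) z.dxVec
  have hp := hasDirDeriv_coord z z.dxVec 4
  have hX := (((hφ.neg.sub ((hp.mul hT).mul hψ)).sub (((hp.mul hp).mul
    ((HasDirDeriv.const 1).add (hT.mul hT))).mul hφ)).of_eventuallyEq hev).2
  rw [prolongXX, totalDx_eq, hX, h0, h1, so3XX]
  have e1 : z.dxVec 1 = 1 := rfl
  have e2 : z.dxVec 2 = z 4 := rfl
  have e4 : z.dxVec 4 = z 6 := rfl
  rw [e1, e2, e4]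
  ring

lemma prolongXXX_so3Comb (hM : IsSo3Domain M) (hQ : ∀ p ∈ M, Q p = so3Comb k r s c p) {z : Jet}
    (hz : z.base ∈ M) : prolongXXX Q z = so3XXX s c z := by
  obtain ⟨h0, h1, h2⟩ := totalDx_so3Comb hM hQ hz
  have hcos : Real.cos (z 2) ≠ 0 := hM.cos_ne_zero _ hz
  have hev : prolongXX Q =ᶠ[𝓝 z] so3XX s c := by
    filter_upwards [eventually_base_mem hM.isOpen hz] with y hy using prolongXX_so3Comb hM hQ hy
  have hT := hasDirDeriv_tan z.dxVec hcos
  have hφ := hasDirDeriv_phi s c (z := z) z.dxVec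
  have hψ := hasDirDeriv_psi s c (z := z) z.dxVec
  have hp := hasDirDeriv_coord z z.dxVec 4
  have hq := hasDirDeriv_coord z z.dxVec 6
  have hn (n : ℝ) := HasDirDeriv.const (z := z) (v := z.dxVec) n
  have hS := (hn 1).add (hT.mul hT)
  have hXX := ((((((hp.mul hT).sub ((((hn 3).mul hp).mul hq).mul hS)).sub
    (((((((hn 2).mul hp).mul hp).mul hp).mul hT).mul hS))).mul hφ).sub
    ((((hn 1).add (((hn 2).mul hq).mul hT)).add ((((hn 2).mul hp).mul hp).mul hS)).mul
      hψ)).of_eventuallyEq hev).2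
  rw [prolongXXX, totalDx_eq, hXX, h0, h1]
  have e1 : z.dxVec 1 = 1 := rfl
  have e2 : z.dxVec 2 = z 4 := rfl
  have e4 : z.dxVec 4 = z 6 := rfl
  have e6 : z.dxVec 6 = z 8 := rfl
  simp only [e1, e2, e4, e6, so3XXX]
  ring

lemma prolongT_so3Comb (hM : IsSo3Domain M) (hQ : ∀ p ∈ M, Q p = so3Comb k r s c p) {z : Jet}
    (hz : z.base ∈ M) :
    prolongT Q z = -(z 4 * (1 + Real.tan (z 2) ^ 2) * so3Phi s c (z 1) * z 3) := by
  have hcos : Real.cos (z.base 2) ≠ 0 := hM.cos_ne_zero _ hz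
  have hev (i : Fin 3) : (fun y : Pt => Q y i) =ᶠ[𝓝 z.base] fun y => so3Comb k r s c y i := by
    filter_upwards [hM.isOpen.mem_nhds hz] with y hy using by rw [hQ _ hy]
  set v : Pt := ![1, 0, z 3] with hv
  have hφ : HasDirDeriv (fun y : Pt => so3Phi s c (y 1)) z.base v _ :=
    HasDirDeriv.comp (hasDerivAt_so3Phi s c (z.base 1)) (hasDirDeriv_coord z.base v 1)
  have hψ : HasDirDeriv (fun y : Pt => so3Psi s c (y 1)) z.base v _ :=
    HasDirDeriv.comp (hasDerivAt_so3Psi s c (z.base 1)) (hasDirDeriv_coord z.base v 1)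
  have hT : HasDirDeriv (fun y : Pt => Real.tan (y 2)) z.base v _ :=
    HasDirDeriv.comp (hasDerivAt_tan' hcos) (hasDirDeriv_coord z.base v 2)
  have h0 := ((HasDirDeriv.const (z := z.base) (v := v) k).of_eventuallyEq (hev 0)).2
  have h1 := (((HasDirDeriv.const r).add (hT.mul hφ)).of_eventuallyEq (hev 1)).2
  have h2 := (hψ.of_eventuallyEq (hev 2)).2
  rw [prolongT, totalDt, totalDt, totalDt, h0, h1, h2]
  have e1 : v 1 = 0 := rfl
  have e2 : v 2 = z 3 := rfl
  have b1 : z.base 1 = z 1 := rfl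
  have b2 : z.base 2 = z 2 := rfl
  rw [e1, e2, b1, b2]
  ring

end Prolongation

/-! The equation is `cos u · u_t = D_x log (K / W ^ (3 / 2))`, where `K / W ^ (3 / 2)` is the
geodesic curvature of the curve `u = u(x)` on the sphere. -/

/-- The square of the speed of a curve `u = u(x)` on the sphere. -/
noncomputable def speedSq (q : EqPt) : ℝ := Real.cos (q 2) * Real.cos (q 2) + q 3 * q 3

/-- The numerator of the geodesic curvature of a curve `u = u(x)` on the sphere. -/
noncomputable def curvNum (q : EqPt) : ℝ :=
  Real.cos (q 2) * q 4 + Real.sin (q 2) * (2 * q 3 * q 3 + Real.cos (q 2) * Real.cos (q 2))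

/-- Half of the total derivative of `speedSq`. -/
noncomputable def speedSqDx (q : EqPt) : ℝ := q 3 * (q 4 - Real.cos (q 2) * Real.sin (q 2))

/-- The part of the total derivative of `curvNum` which does not contain `u_xxx`. -/
noncomputable def curvNumDx (q : EqPt) : ℝ :=
  Real.cos (q 2) * q 3 * (2 * q 3 * q 3 + Real.cos (q 2) * Real.cos (q 2))
    + Real.sin (q 2) * (3 * q 3 * q 4 - 2 * Real.cos (q 2) * Real.sin (q 2) * q 3)

/-- The coefficient `F` of the invariant equation. -/
noncomputable def invF (q : EqPt) : ℝ := 1 / curvNum q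

/-- The coefficient `G` of the invariant equation. -/
noncomputable def invG (q : EqPt) : ℝ :=
  (curvNumDx q / curvNum q - 3 * speedSqDx q / speedSq q) / Real.cos (q 2)

lemma speedSq_pos {q : EqPt} (hq : Real.cos (q 2) ≠ 0) : 0 < speedSq q := by
  have := mul_self_nonneg (q 3)
  have := mul_self_pos.2 hq
  rw [speedSq]
  linarith

/-- With h = D_x ξ, where ξ is the ∂_x-component, the prolonged field scales speedSq by -2h, curvNum
by -3h and cos u · u_t by -h. Hence curvNum / speedSq^(3/2) is invariant, its D_x log scales by -h,
and the two sides of the equation match. Since F and G do not depend on t, `k` plays no role. -/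
lemma isSymmetry_so3Comb {M : Set Pt} (hM : IsSo3Domain M) {Q : Pt → Pt} {k r s c : ℝ}
    (hQ : ∀ p ∈ M, Q p = so3Comb k r s c p) :
    IsSymmetry {q | q.base ∈ M ∧ curvNum q ≠ 0} invF invG Q := by
  rintro z ⟨hzM, hK0⟩ hz3 Q'
  have hz : z.base ∈ M := hzM
  have hC0 : Real.cos (z 2) ≠ 0 := hM.cos_ne_zero _ hz
  have hW0 : speedSq z.eqPt ≠ 0 := (speedSq_pos (q := z.eqPt) hC0).ne'
  have v2 : Q' 2 = so3Psi s c (z 1) := congrFun (hQ _ hz) 2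
  have v3 : Q' 3 = so3X s c z := prolongX_so3Comb hM hQ hz
  have v4 : Q' 4 = so3XX s c z := prolongXX_so3Comb hM hQ hz
  have hcos : HasDirDeriv (fun q : EqPt => Real.cos (q 2)) z.eqPt Q' _ :=
    HasDirDeriv.comp (Real.hasDerivAt_cos (z.eqPt 2)) (hasDirDeriv_coord z.eqPt Q' 2)
  have hsin : HasDirDeriv (fun q : EqPt => Real.sin (q 2)) z.eqPt Q' _ :=
    HasDirDeriv.comp (Real.hasDerivAt_sin (z.eqPt 2)) (hasDirDeriv_coord z.eqPt Q' 2)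
  have hp := hasDirDeriv_coord z.eqPt Q' 3
  have hq := hasDirDeriv_coord z.eqPt Q' 4
  have hn (n : ℝ) := HasDirDeriv.const (z := z.eqPt) (v := Q') n
  rw [v2] at hcos hsin
  rw [v3] at hp
  rw [v4] at hq
  have e2 : z.eqPt 2 = z 2 := rfl
  have e3 : z.eqPt 3 = z 4 := rfl
  have e4 : z.eqPt 4 = z 6 := rfl
  have hT : Real.sin (z 2) = Real.tan (z 2) * Real.cos (z 2) := (Real.tan_mul_cos hC0).symm
  have hSC : (1 + Real.tan (z 2) ^ 2) * Real.cos (z 2) ^ 2 = 1 := by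
    have h1 := Real.sin_sq_add_cos_sq (z 2)
    rw [hT] at h1
    linear_combination h1
  set h : ℝ := Real.tan (z 2) * so3Psi s c (z 1)
    + (1 + Real.tan (z 2) ^ 2) * so3Phi s c (z 1) * z 4 with hh
  -- This is D_x h.
  set hx : ℝ := 2 * (1 + Real.tan (z 2) ^ 2) * z 4 * so3Psi s c (z 1)
    - Real.tan (z 2) * so3Phi s c (z 1)
    + 2 * Real.tan (z 2) * (1 + Real.tan (z 2) ^ 2) * z 4 ^ 2 * so3Phi s c (z 1)
    + (1 + Real.tan (z 2) ^ 2) * z 6 * so3Phi s c (z 1) with hhx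
  have hW : HasDirDeriv speedSq z.eqPt Q' (-2 * h * speedSq z.eqPt) := by
    refine ((hcos.mul hcos).add (hp.mul hp)).congr ?_
    simp only [speedSq, so3X, e2, e3, hT, hh]
    linear_combination 2 * z 4 * so3Phi s c (z 1) * hSC
  have hK : HasDirDeriv curvNum z.eqPt Q' (-3 * h * curvNum z.eqPt) := by
    refine ((hcos.mul hq).add (hsin.mul ((((hn 2).mul hp).mul hp).add (hcos.mul hcos)))).congr ?_
    simp only [curvNum, so3X, so3XX, e2, e3, e4, hT, hh]
    linear_combination Real.cos (z 2) * (3 * z 4 * Real.tan (z 2) * so3Phi s c (z 1)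
      + so3Psi s c (z 1)) * hSC
  -- Here and in `hP` the formula comes from pr Q (D_x f) = D_x (pr Q f) - h D_x f, with f = speedSq
  -- (halved) and f = curvNum. In `hP` the contribution of the term cos u · u_xxx of D_x curvNum is
  -- moved to the right.
  have hR : HasDirDeriv speedSqDx z.eqPt Q'
      (-3 * h * speedSqDx z.eqPt - hx * speedSq z.eqPt) := by
    refine (hp.mul (hq.sub (hcos.mul hsin))).congr ?_
    simp only [speedSqDx, speedSq, so3X, so3XX, e2, e3, e4, hT, hh, hhx]
    linear_combination (z 6 * so3Phi s c (z 1) + z 4 * so3Psi s c (z 1)) * hSC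
  have hP : HasDirDeriv curvNumDx z.eqPt Q' (-4 * h * (Real.cos (z 2) * z 8 + curvNumDx z.eqPt)
      - 3 * hx * curvNum z.eqPt + Real.tan (z 2) * Real.cos (z 2) * so3Psi s c (z 1) * z 8
      - Real.cos (z 2) * so3XXX s c z) := by
    refine (((hcos.mul hp).mul ((((hn 2).mul hp).mul hp).add (hcos.mul hcos))).add
      (hsin.mul ((((hn 3).mul hp).mul hq).sub
        ((((hn 2).mul hcos).mul hsin).mul hp)))).congr ?_
    simp only [curvNumDx, curvNum, so3X, so3XX, so3XXX, e2, e3, e4, hT, hh, hhx]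
    linear_combination Real.cos (z 2) * (-Real.tan (z 2) * z 4
      * (3 * z 4 * Real.tan (z 2) * so3Phi s c (z 1) + so3Psi s c (z 1))
      + 3 * z 6 * Real.tan (z 2) * so3Phi s c (z 1)
      + 3 * z 4 * (1 + Real.tan (z 2) ^ 2) * z 4 * so3Phi s c (z 1)
      + 3 * z 4 * Real.tan (z 2) * so3Psi s c (z 1) - so3Phi s c (z 1)) * hSC
  have hF := ((hn 1).div hK hK0).2
  have hG := (((hP.div hK hK0).sub (((hn 3).mul hR).div hW hW0)).div hcos hC0).2
  change fderiv ℝ invF z.eqPt Q' = _ at hF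
  change fderiv ℝ invG z.eqPt Q' = _ at hG
  rw [hF, hG, prolongT_so3Comb hM hQ hz, prolongXXX_so3Comb hM hQ hz, hz3, invF, invG, e2, hT]
  have hS : (1 + Real.tan (z 2) ^ 2) * so3Phi s c (z 1) * z 4
      = h - Real.tan (z 2) * so3Psi s c (z 1) := by
    rw [hh]
    ring
  rw [show z 4 * (1 + Real.tan (z 2) ^ 2) * so3Phi s c (z 1)
      = h - Real.tan (z 2) * so3Psi s c (z 1) by rw [← hS]; ring]
  generalize so3Psi s c (z 1) = ψ
  generalize so3XXX s c z = X3
  generalize curvNumDx z.eqPt = P at *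
  generalize curvNum z.eqPt = K at *
  generalize speedSqDx z.eqPt = R at *
  generalize speedSq z.eqPt = W at *
  generalize Real.cos (z 2) = C at *
  clear_value h hx
  field_simp
  ring

lemma isAdmissible_so3_dtField {M : Set Pt} (hM : IsSo3Domain M) :
    IsAdmissible M (Set.range (so3Field M) ∪ Submodule.span ℝ {dtField M}) := by
  have hcoord (i : Fin 5) : ContDiff ℝ ∞ fun q : EqPt => q i := contDiff_apply ℝ ℝ i
  have hc : ContDiff ℝ ∞ fun q : EqPt => Real.cos (q 2) := (hcoord 2).cos
  have hs : ContDiff ℝ ∞ fun q : EqPt => Real.sin (q 2) := (hcoord 2).sin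
  have hK : ContDiff ℝ ∞ curvNum := (hc.mul (hcoord 4)).add
    (hs.mul (((contDiff_const.mul (hcoord 3)).mul (hcoord 3)).add (hc.mul hc)))
  have hW : ContDiff ℝ ∞ speedSq := (hc.mul hc).add ((hcoord 3).mul (hcoord 3))
  have hR : ContDiff ℝ ∞ speedSqDx := (hcoord 3).mul ((hcoord 4).sub (hc.mul hs))
  have hP : ContDiff ℝ ∞ curvNumDx :=
    ((hc.mul (hcoord 3)).mul (((contDiff_const.mul (hcoord 3)).mul (hcoord 3)).add
      (hc.mul hc))).add (hs.mul (((contDiff_const.mul (hcoord 3)).mul (hcoord 4)).sub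
        (((contDiff_const.mul hc).mul hs).mul (hcoord 3))))
  refine ⟨{q | q.base ∈ M ∧ curvNum q ≠ 0}, invF, invG, ?_, ?_, ?_, ?_, ?_, ?_⟩
  · refine IsOpen.inter (t := {q | curvNum q ≠ 0}) ?_ (isOpen_ne_fun hK.continuous continuous_const)
    rw [EqPt.base_eq]
    exact hM.isOpen.preimage EqPt.baseL.continuous
  · refine Set.Subset.antisymm ?_ fun p hp => ?_
    · rintro _ ⟨q, hq, rfl⟩
      exact hq.1
    · have hcos := hM.cos_ne_zero p hp
      -- With u_x = 0, this value of u_xx makes `curvNum` equal to 1.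
      have hb : EqPt.base ![p 0, p 1, p 2, 0,
          (1 - Real.sin (p 2) * Real.cos (p 2) ^ 2) / Real.cos (p 2)] = p := by
        ext i
        fin_cases i <;> rfl
      refine ⟨_, ⟨hb.symm ▸ hp, ?_⟩, hb⟩
      simp only [curvNum]
      simp
      field_simp
      norm_num
  · exact contDiffOn_const.div hK.contDiffOn fun q hq => hq.2
  · exact ((hP.contDiffOn.div hK.contDiffOn fun q hq => hq.2).sub
      ((contDiffOn_const.mul hR.contDiffOn).div hW.contDiffOn fun q hq =>
        (speedSq_pos (hM.cos_ne_zero _ hq.1)).ne')).div hc.contDiffOn fun q hq =>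
        hM.cos_ne_zero _ hq.1
  · rintro W hW - ⟨q, hq⟩
    exact ⟨q, hq, one_div_ne_zero (hW hq).2⟩
  · rintro Q (⟨i, rfl⟩ | hQ)
    · have hcomb : ∃ r s c : ℝ, ∀ p ∈ M, so3Field M i p = so3Comb 0 r s c p := by
        refine ⟨![1, 0, 0] i, ![0, 1, 0] i, ![0, 0, 1] i, fun p hp => ?_⟩
        rw [so3Field_of_mem hp]
        ext j
        fin_cases i <;> fin_cases j <;> simp [so3Fun, so3Comb]
      obtain ⟨r, s, c, h⟩ := hcomb
      exact isSymmetry_so3Comb hM h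
    · obtain ⟨k, rfl⟩ := Submodule.mem_span_singleton.1 hQ
      refine isSymmetry_so3Comb hM (k := k) (r := 0) (s := 0) (c := 0) fun p hp => ?_
      rw [Pi.smul_apply, dtField, Set.indicator_of_mem hp]
      ext j
      fin_cases j <;> simp [so3Comb]

end EvolSym

theorem theorem6p1 (M : Set EvolSym.Pt) (hM : EvolSym.IsSo3Domain M) :
    -- `⟨∂_t⟩` is a one-dimensional abelian irreducible representation space, and it is admissible
    -- together with the realization of `so(3, ℝ)`
    (EvolSym.IsAbelianIrrep M (Submodule.span ℝ {EvolSym.dtField M}) ∧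
      Module.finrank ℝ (Submodule.span ℝ {EvolSym.dtField M}) = 1 ∧
      EvolSym.IsAdmissible M
        (Set.range (EvolSym.so3Field M) ∪ Submodule.span ℝ {EvolSym.dtField M})) ∧
    -- every admissible one is one-dimensional and equivalent to `⟨∂_t⟩`
    (∀ A : Submodule ℝ (EvolSym.Pt → EvolSym.Pt),
      EvolSym.IsAbelianIrrep M A →
      EvolSym.IsAdmissible M (A : Set (EvolSym.Pt → EvolSym.Pt)) →
        Module.finrank ℝ A = 1 ∧
        ∃ M' : Set EvolSym.Pt, EvolSym.IsSo3Domain M' ∧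
          EvolSym.So3Equivalent M A M' (Submodule.span ℝ {EvolSym.dtField M'})) := by
  obtain ⟨hirr, hrank⟩ := EvolSym.isAbelianIrrep_span_dtField hM
  refine ⟨⟨hirr, hrank, EvolSym.isAdmissible_so3_dtField hM⟩, fun A hA hadm => ?_⟩
  obtain ⟨Q, rfl, hQ0, hQs, hQ, hQt⟩ := hA.exists_time_field hM hadm
  exact ⟨finrank_span_singleton hQ0, EvolSym.exists_so3Equivalent_dtField hM hQs hQ hQt⟩
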